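/- Write $\pi\in S_n$ ($n\ge 0$) in one-line notation $[\pi_1\,\cdots\,\pi_n]$; $e_n\in S_n$ is the identity. A recoil of $\pi$ is a value $i\in\{1,\dots,n-1\}$ that occurs after $i+1$ in $\pi$. Call $\pi$ rectangular if it avoids the patterns $2413,2431,4213,4231$, and evil-avoiding if it avoids $2413,4132,4213,3214$. Let $\mathrm{Rect}(n,k)$ and $\mathrm{Evil}(n,k)$ be the sets of rectangular, respectively evil-avoiding, permutations in $S_n$ with exactly $k$ recoils. For $\pi\in S_n$ let $\rho_{i,j}(\pi)\in S_{n+1}$ be obtained by increasing by $1$ all entries of $\pi$ that are $\ge i$ and then inserting the value $i$ at position $j$; for $a>b$ let $\gamma_{a,b}(\pi)\in S_n$ be obtained by removing the entry at position $a$ and reinserting it at position $b$. Define the following partial operators. * On rectangular permutations $\pi$: $\psi_1(\pi)=\rho_{1,1}(\pi)$ for all $\pi$; $\psi_2(\pi)=\rho_{1,2}(\pi)$ and $\psi_u(\pi)=\rho_{\pi_1,1}(\pi)$ for $\pi$ of size at least $1$ with $\pi_1\ne 1$; $\psi_d(\pi)=\rho_{\pi_1+1,1}(\pi)$ for $\pi$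 of size at least $1$. * On evil-avoiding permutations $\pi\in S_n$: $\psi_p(\pi)=\rho_{1,1}(\pi)$ for $\pi\neq e_n$. For $\pi\ne e_n$ with least recoil $t$, $\psi_q(\pi)=\rho_{t+1,1}(\pi)$, unless there are integers $a\ge 0$, $b\ge 1$ with $a+b\le n$ such that $\pi$ begins with $1,2,\dots,a$ and ends with $a+1,\dots,a+b$, in which case $\psi_q(\pi)=\gamma_{n-b+2,\,a+2}(\rho_{t+1,1}(\pi))$. $\psi_r(\pi)=\rho_{1,n+1}(\pi)$ for $n\ge 1$. $\psi_s(\pi)=\rho_{\pi_n+1,n+1}(\pi)$ if $\pi$ ends with $1,2,\dots,t$ for some $t\ge 1$, and $\psi_s(e_0)=e_1$. A word $x_1x_2\cdots x_m$ over $\{1,2,u,d\}$ or over $\{p,q,r,s\}$ encodes the permutation $\psi_{x_1}\circ\psi_{x_2}\circ\cdots\circ\psi_{x_m}(e_0)$ if this composition is defined. Let $L_{\mathrm{Rect}}$ and $L_{\mathrm{Evil}}$ be the sets of words of positive length over $\{1,2,u,d\}$, respectively $\{p,q,r,s\}$, that encode a permutation. For a word $w$ over $\{1,2,u,d\}$ let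 $b(w)$ be obtained by substituting $2\mapsto p$, $u\mapsto q$, $d\mapsto r$, $1\mapsto s$ and then reversing the prefix before the last $r$, if there is an $r$. **Theorem.** 1. Each $w\in L_{\mathrm{Rect}}$ encodes exactly one permutation; it lies in $\mathrm{Rect}(n,k)$, where $n$ is the length of $w$ and $k$ is the number of letters $d$ in $w$. For all $n\ge1$ and $k\ge 0$, each $\pi\in \mathrm{Rect}(n,k)$ is encoded by exactly one word over $\{1,2,u,d\}$; this word is in $L_{\mathrm{Rect}}$, has length $n$, and has $k$ letters $d$. 2. The same holds for $L_{\mathrm{Evil}}$, words over $\{p,q,r,s\}$ and $\mathrm{Evil}(n,k)$, with the letter $r$ in place of $d$. 3. $b$ restricts to a bijection $L_{\mathrm{Rect}}\to L_{\mathrm{Evil}}$, which preserves length and for which the number of letters $r$ in $b(w)$ equals the number of letters $d$ in $w$. 4. Consequently, for all $n,k\ge 0$ there is a bijection $\Phi:\mathrm{Rect}(n,k)\to\mathrm{Evil}(n,k)$ given explicitly by: $\Phi(\pi)=\tau$ if and only if there is a word $w$ over $\{1,2,u,d\}$ (the empty word when $n=0$) that encodes $\pi$ and such that $b(w)$ encodes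 $\tau$. 5. In particular $|\mathrm{Rect}(n,k)|=|\mathrm{Evil}(n,k)|$ for all $n,k\ge 0$; that is, the rectangular and the evil-avoiding permutations are strongly Wilf-equivalent. -/

import Mathlib

namespace RectEvil

open Equiv

/-! Throughout, `S_n` is `Equiv.Perm (Fin n)`, and `π i` is the entry of `π` at position `i`.
Positions and values are counted from `0`, so that the position (or value) usually called `j` is
the element `j - 1` of `Fin n`. -/

/-! ### Patterns, recoils and the two classes -/

/-- `π` contains the pattern with one-line notation `p`: some subsequence of the values of `π`
has the same relative order as `p`. -/
def Contains {n m : ℕ} (π : Perm (Fin n)) (p : Fin m → ℕ) : Prop :=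
  ∃ f : Fin m → Fin n, StrictMono f ∧ ∀ i j, p i < p j ↔ π (f i) < π (f j)

/-- Rectangular permutations. -/
def IsRect {n : ℕ} (π : Perm (Fin n)) : Prop :=
  ¬ Contains π ![2, 4, 1, 3] ∧ ¬ Contains π ![2, 4, 3, 1] ∧
    ¬ Contains π ![4, 2, 1, 3] ∧ ¬ Contains π ![4, 2, 3, 1]

/-- Evil-avoiding permutations. -/
def IsEvil {n : ℕ} (π : Perm (Fin n)) : Prop :=
  ¬ Contains π ![2, 4, 1, 3] ∧ ¬ Contains π ![4, 1, 3, 2] ∧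
    ¬ Contains π ![4, 2, 1, 3] ∧ ¬ Contains π ![3, 2, 1, 4]

/-- The recoils of `π`: the values `v` such that `v + 1` is also a value of `π` and occurs
before `v`. -/
def recoils {n : ℕ} (π : Perm (Fin n)) : Set (Fin n) :=
  {v | ∃ h : (v : ℕ) + 1 < n, π⁻¹ ⟨(v : ℕ) + 1, h⟩ < π⁻¹ v}

/-- The number of recoils. -/
noncomputable def recoilCount {n : ℕ} (π : Perm (Fin n)) : ℕ := (recoils π).ncard

/-- Rectangular permutations in `S_n` with `k` recoils. -/
def Rect (n k : ℕ) : Set (Perm (Fin n)) := {π | IsRect π ∧ recoilCount π = k}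

/-- Evil-avoiding permutations in `S_n` with `k` recoils. -/
def Evil (n k : ℕ) : Set (Perm (Fin n)) := {π | IsEvil π ∧ recoilCount π = k}

/-- Two classes of permutations are strongly Wilf-equivalent if for all `n` and `k` they have
equally many members in `S_n` with `k` recoils. -/
def StronglyWilfEquivalent (C D : ∀ n : ℕ, Set (Perm (Fin n))) : Prop :=
  ∀ n k : ℕ, {π ∈ C n | recoilCount π = k}.ncard = {π ∈ D n | recoilCount π = k}.ncard

/-! ### Operators on permutations -/

/-- The insertion operator: increase by one all entries of `π` that are at least `v`, then insert
the value `v` at position `j`. (The result sends `j` to `v` and `j.succAbove k` to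
`v.succAbove (π k)`.) -/
def insertion {n : ℕ} (v j : Fin (n + 1)) (π : Perm (Fin n)) : Perm (Fin (n + 1)) :=
  (finSuccEquiv' j).trans ((optionCongr π).trans (finSuccEquiv' v).symm)

/-- The shifting operator: for `b ≤ a`, remove the entry of `π` at position `a` and put it back at
position `b`. -/
def shift {n : ℕ} (a b : Fin n) (π : Perm (Fin n)) : Perm (Fin n) :=
  π * (Fin.cycleIcc b a)⁻¹

/-- The alphabet `{1, 2, u, d}`. -/
inductive RectLetter
  | one | two | u | d
  deriving DecidableEq

/-- The alphabet `{p, q, r, s}`. -/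
inductive EvilLetter
  | p | q | r | s
  deriving DecidableEq

/-- `RectStep x π σ`: the permutation `π` is in the domain of the (partial) operator `ψ_x`, and
`ψ_x(π) = σ`. -/
inductive RectStep : RectLetter → ∀ {n : ℕ}, Perm (Fin n) → Perm (Fin (n + 1)) → Prop
  | one {n : ℕ} (π : Perm (Fin n)) (h : IsRect π) :
      RectStep .one π (insertion 0 0 π)
  | two {n : ℕ} (π : Perm (Fin (n + 1))) (h : IsRect π) (h0 : π 0 ≠ 0) :
      RectStep .two π (insertion 0 1 π)
  | u {n : ℕ} (π : Perm (Fin (n + 1))) (h : IsRect π) (h0 : π 0 ≠ 0) :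
      RectStep .u π (insertion (π 0).castSucc 0 π)
  | d {n : ℕ} (π : Perm (Fin (n + 1))) (h : IsRect π) :
      RectStep .d π (insertion (π 0).succ 0 π)

/-- `π` is `(a, b)`-sandwiched: it begins with the `a ≥ 0` smallest values in increasing order and
ends with the `b ≥ 1` next smallest values in increasing order. -/
def Sandwiched {n : ℕ} (a b : ℕ) (π : Perm (Fin n)) : Prop :=
  0 < b ∧ a + b ≤ n ∧ (∀ i : Fin n, (i : ℕ) < a → (π i : ℕ) = i) ∧
    ∀ i : Fin n, n - b ≤ (i : ℕ) → (π i : ℕ) = a + (i - (n - b))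

/-- For some `t ≥ 1`, the last `t` entries of `π` are its `t` smallest values in increasing
order. -/
def EndsWithIdentity {n : ℕ} (π : Perm (Fin n)) : Prop :=
  ∃ t : ℕ, 0 < t ∧ t ≤ n ∧ ∀ i : Fin n, n - t ≤ (i : ℕ) → (π i : ℕ) = i - (n - t)

/-- `EvilStep x π σ`: the permutation `π` is in the domain of the (partial) operator `ψ_x`, and
`ψ_x(π) = σ`. In the two cases of `ψ_q`, `t` is the least recoil of `π`; in the sandwiched case the
entry at the position `i = n - b + 1` is moved to the position `j = a + 1` (counting from `0`). -/
inductive EvilStep : EvilLetter → ∀ {n : ℕ}, Perm (Fin n) → Perm (Fin (n + 1)) → Prop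
  | p {n : ℕ} (π : Perm (Fin n)) (h : IsEvil π) (h1 : π ≠ 1) :
      EvilStep .p π (insertion 0 0 π)
  | q_plain {n : ℕ} (π : Perm (Fin n)) (h : IsEvil π) (h1 : π ≠ 1)
      (t : Fin n) (ht : IsLeast (recoils π) t) (hs : ¬ ∃ a b : ℕ, Sandwiched a b π) :
      EvilStep .q π (insertion t.succ 0 π)
  | q_sandwiched {n : ℕ} (π : Perm (Fin n)) (h : IsEvil π) (h1 : π ≠ 1)
      (t : Fin n) (ht : IsLeast (recoils π) t) (a b : ℕ) (hs : Sandwiched a b π)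
      (i j : Fin (n + 1)) (hi : (i : ℕ) + b = n + 1) (hj : (j : ℕ) = a + 1) :
      EvilStep .q π (shift i j (insertion t.succ 0 π))
  | r {n : ℕ} (π : Perm (Fin (n + 1))) (h : IsEvil π) :
      EvilStep .r π (insertion 0 (Fin.last (n + 1)) π)
  | s_zero (π : Perm (Fin 0)) :
      EvilStep .s π (insertion 0 0 π)
  | s_succ {n : ℕ} (π : Perm (Fin (n + 1))) (h : IsEvil π) (hs : EndsWithIdentity π) :
      EvilStep .s π (insertion (π (Fin.last n)).succ (Fin.last (n + 1)) π)

/-! ### The languages and the map between them -/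

/-- The word `x₁ x₂ ⋯ x_m` encodes `π`: the composition `ψ_{x₁} ∘ ⋯ ∘ ψ_{x_m}` is defined at the
permutation of `S_0`, and its value there is `π`. -/
inductive RectEncodes : List RectLetter → ∀ {n : ℕ}, Perm (Fin n) → Prop
  | nil : RectEncodes [] (1 : Perm (Fin 0))
  | cons {w : List RectLetter} {n : ℕ} {π : Perm (Fin n)} {σ : Perm (Fin (n + 1))}
      (x : RectLetter) (hw : RectEncodes w π) (hx : RectStep x π σ) : RectEncodes (x :: w) σ

/-- The analogue of `RectEncodes` for the operators `ψ_p, ψ_q, ψ_r, ψ_s`. -/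
inductive EvilEncodes : List EvilLetter → ∀ {n : ℕ}, Perm (Fin n) → Prop
  | nil : EvilEncodes [] (1 : Perm (Fin 0))
  | cons {w : List EvilLetter} {n : ℕ} {π : Perm (Fin n)} {σ : Perm (Fin (n + 1))}
      (x : EvilLetter) (hw : EvilEncodes w π) (hx : EvilStep x π σ) : EvilEncodes (x :: w) σ

/-- The words of positive length in `1, 2, u, d` whose composition is defined at the permutation
of `S_0`. -/
def LRect : Set (List RectLetter) :=
  {w | w ≠ [] ∧ ∃ (n : ℕ) (π : Perm (Fin n)), RectEncodes w π}

/-- The words of positive length in `p, q, r, s` whose composition is defined at the permutation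
of `S_0`. -/
def LEvil : Set (List EvilLetter) :=
  {w | w ≠ [] ∧ ∃ (n : ℕ) (π : Perm (Fin n)), EvilEncodes w π}

/-- The substitution `2 ↦ p`, `u ↦ q`, `d ↦ r`, `1 ↦ s`. -/
def letterMap : RectLetter → EvilLetter
  | .two => .p
  | .u => .q
  | .d => .r
  | .one => .s

/-- Reverse the prefix before the last `r`, if there is an `r`. -/
def reversePrefix (v : List EvilLetter) : List EvilLetter :=
  if .r ∈ v then
    (v.rdropWhile (· ≠ .r)).dropLast.reverse ++ .r :: v.rtakeWhile (· ≠ .r)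
  else v

/-- The map `b` from words in `1, 2, u, d` to words in `p, q, r, s`. -/
def wordMap (w : List RectLetter) : List EvilLetter := reversePrefix (w.map letterMap)

end RectEvil

/-!
Both parts about a single language rest on the same principle (`IsEncoding`): if each member of a
class of permutations in `S_{n+1}` arises from a member in `S_n` by exactly one step, if steps are
functional and stay in the class, and if exactly the steps with one distinguished letter create a
recoil, then words and permutations correspond bijectively, the word recording the history of the
permutation.

All operators are insertions of an entry, up to moving one entry. An insertion of the value `v` can
only affect the recoils `v - 1` and `v` (`recoilCount_insertion`), which settles the recoil counts.

For rectangular permutations the step is undone by looking at the first two entries. If the first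
entry is not the smallest value, then avoidance forces the second entry to be a neighbour of the
first one in value (steps `d` and `u`) or the smallest value (step `2`), since otherwise the
smallest value and a neighbour of the first entry complete a pattern (`exists_rectStep`).

For evil-avoiding permutations `σ` the steps `r` and `s` are those that produce a `σ` ending with
its smallest values in increasing order, and `p` and `q` are told apart by the first entry. The core
is the inversion of `q`. If `σ` does not end with its smallest values in increasing order, then the
values below its first entry `v` occur in increasing order (`IsEvil.lt_of_apply_lt`). Either these
values form two blocks, one directly after `v` and one at the end of `σ` (`Wrapped`); this is
exactly the shape produced in the sandwiched case of `ψ_q`. Or the first entry can simply be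
removed: the pattern `2413` then forces `v + 1` to precede `v - 1`, so that `v - 1` becomes
the least recoil (`exists_evilStep_of_not_wrapped`). In the other direction, an occurrence of a pattern can never use
the sorted blocks of a sandwiched permutation (`EvilPattern.mem_middle`) or the first block of a
wrapped one (`Wrapped.evilPattern`), so that evil-avoidance survives the move of an entry between
the blocks.

Which steps are possible depends only on the previous letters, so both languages are given by local
conditions. After replacing letters by `letterMap`, either language consists of the nonempty words
in `s` alone and of the words `x r s^k` with `k ≥ 1` in which certain letters may not be
neighbours in `x`: `ps` and `qs` are forbidden for the first language, `sp` and
`sq` for the second one. Reversing `x` exchanges the two conditions (`exists_evilEncodes_wordMap_iff`).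
-/

namespace RectEvil

open Equiv

/-! ### Insertions -/

@[simp]
theorem insertion_self {n : ℕ} (v j : Fin (n + 1)) (π : Perm (Fin n)) :
    insertion v j π j = v := by
  simp [insertion]

@[simp]
theorem insertion_succAbove {n : ℕ} (v j : Fin (n + 1)) (π : Perm (Fin n)) (k : Fin n) :
    insertion v j π (j.succAbove k) = v.succAbove (π k) := by
  simp [insertion]

@[simp]
theorem insertion_zero_succ {n : ℕ} (v : Fin (n + 1)) (π : Perm (Fin n)) (k : Fin n) :
    insertion v 0 π k.succ = v.succAbove (π k) := by
  simpa using insertion_succAbove v 0 π k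

@[simp]
theorem insertion_last_castSucc {n : ℕ} (v : Fin (n + 1)) (π : Perm (Fin n)) (k : Fin n) :
    insertion v (Fin.last n) π k.castSucc = v.succAbove (π k) := by
  simpa using insertion_succAbove v (Fin.last n) π k

theorem insertion_inv {n : ℕ} (v j : Fin (n + 1)) (π : Perm (Fin n)) :
    (insertion v j π)⁻¹ = insertion j v π⁻¹ := by
  rw [inv_eq_iff_mul_eq_one]
  ext k : 1
  rcases Fin.eq_self_or_eq_succAbove v k with rfl | ⟨k, rfl⟩ <;> simp

theorem insertion_injective {n : ℕ} (v j : Fin (n + 1)) :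
    Function.Injective (insertion v j) := by
  intro π π' h
  ext k : 1
  have := congrArg (fun σ : Perm (Fin (n + 1)) => σ (j.succAbove k)) h
  simpa using this

theorem insertion_eq_insertion {n : ℕ} {v v' j : Fin (n + 1)} {π π' : Perm (Fin n)}
    (h : insertion v j π = insertion v' j π') : π = π' := by
  have : v = v' := by rw [← insertion_self v j π, h, insertion_self]
  subst this
  exact insertion_injective _ _ h

/-- Every permutation arises by reinserting any one of its entries. -/
theorem exists_insertion_eq {n : ℕ} (σ : Perm (Fin (n + 1))) (j : Fin (n + 1)) :
    ∃ π : Perm (Fin n), insertion (σ j) j π = σ := by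
  have h : ∀ k : Fin n, ∃ k', (σ j).succAbove k' = σ (j.succAbove k) := fun k =>
    Fin.exists_succAbove_eq (σ.injective.ne (Fin.succAbove_ne j k))
  choose f hf using h
  have hinj : Function.Injective f := by
    intro a b hab
    have : σ (j.succAbove a) = σ (j.succAbove b) := by rw [← hf, ← hf, hab]
    exact Fin.succAbove_right_injective (σ.injective this)
  refine ⟨Equiv.ofBijective f (Finite.injective_iff_bijective.mp hinj), ?_⟩
  ext k : 1
  rcases Fin.eq_self_or_eq_succAbove j k with rfl | ⟨k, rfl⟩ <;> simp [hf]

/-- Moving the inserted entry amounts to inserting it elsewhere. -/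
theorem shift_insertion {n : ℕ} (v : Fin (n + 1)) {i j : Fin (n + 1)} (hji : j ≤ i)
    (ρ : Perm (Fin n)) : shift i j (insertion v i ρ) = insertion v j ρ := by
  rw [shift, mul_inv_eq_iff_eq_mul]
  ext k : 1
  rcases Fin.eq_self_or_eq_succAbove i k with rfl | ⟨k, rfl⟩
  · simp [Fin.cycleIcc_of_last hji]
  · have := congrFun (Fin.cycleIcc_comp_succAbove j i hji) k
    simp only [Function.comp_apply] at this
    simp [this]

/-! ### Pattern occurrences -/

/-- Positions `i, j` (in either order) followed by positions `k, l` (in either order) that form an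
occurrence of one of the four patterns `2413, 2431, 4213, 4231`. -/
def RectPattern {n : ℕ} (π : Perm (Fin n)) (i j k l : Fin n) : Prop :=
  i < k ∧ i < l ∧ j < k ∧ j < l ∧ π k < π i ∧ π i < π l ∧ π l < π j

/-- Positions `i < j < k < l` that form an occurrence of one of the four patterns
`2413, 4132, 4213, 3214`. -/
def EvilPattern {n : ℕ} (π : Perm (Fin n)) (i j k l : Fin n) : Prop :=
  i < j ∧ j < k ∧ k < l ∧
    ((π k < π i ∧ π i < π l ∧ π l < π j) ∨ (π j < π l ∧ π l < π k ∧ π k < π i) ∨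
      (π k < π j ∧ π j < π l ∧ π l < π i) ∨ (π k < π j ∧ π j < π i ∧ π i < π l))

theorem contains_iff {n : ℕ} (π : Perm (Fin n)) (p : Fin 4 → ℕ) :
    Contains π p ↔ ∃ a b c d : Fin n, a < b ∧ b < c ∧ c < d ∧
      ∀ i j, p i < p j ↔ π (![a, b, c, d] i) < π (![a, b, c, d] j) := by
  constructor
  · rintro ⟨f, hf, h⟩
    refine ⟨f 0, f 1, f 2, f 3, hf (by decide), hf (by decide), hf (by decide), ?_⟩
    have : ![f 0, f 1, f 2, f 3] = f := by
      ext i; fin_cases i <;> rfl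
    rwa [this]
  · rintro ⟨a, b, c, d, hab, hbc, hcd, h⟩
    refine ⟨![a, b, c, d], ?_, h⟩
    rw [Fin.strictMono_iff_lt_succ]
    intro i
    fin_cases i
    exacts [hab, hbc, hcd]

theorem contains_2413 {n : ℕ} {π : Perm (Fin n)} : Contains π ![2, 4, 1, 3] ↔ ∃ a b c d,
    a < b ∧ b < c ∧ c < d ∧ π c < π a ∧ π a < π d ∧ π d < π b := by
  simp only [contains_iff, Fin.forall_fin_succ]
  simp
  grind

theorem contains_2431 {n : ℕ} {π : Perm (Fin n)} : Contains π ![2, 4, 3, 1] ↔ ∃ a b c d,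
    a < b ∧ b < c ∧ c < d ∧ π d < π a ∧ π a < π c ∧ π c < π b := by
  simp only [contains_iff, Fin.forall_fin_succ]
  simp
  grind

theorem contains_4213 {n : ℕ} {π : Perm (Fin n)} : Contains π ![4, 2, 1, 3] ↔ ∃ a b c d,
    a < b ∧ b < c ∧ c < d ∧ π c < π b ∧ π b < π d ∧ π d < π a := by
  simp only [contains_iff, Fin.forall_fin_succ]
  simp
  grind

theorem contains_4231 {n : ℕ} {π : Perm (Fin n)} : Contains π ![4, 2, 3, 1] ↔ ∃ a b c d,
    a < b ∧ b < c ∧ c < d ∧ π d < π b ∧ π b < π c ∧ π c < π a := by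
  simp only [contains_iff, Fin.forall_fin_succ]
  simp
  grind

theorem contains_4132 {n : ℕ} {π : Perm (Fin n)} : Contains π ![4, 1, 3, 2] ↔ ∃ a b c d,
    a < b ∧ b < c ∧ c < d ∧ π b < π d ∧ π d < π c ∧ π c < π a := by
  simp only [contains_iff, Fin.forall_fin_succ]
  simp
  grind

theorem contains_3214 {n : ℕ} {π : Perm (Fin n)} : Contains π ![3, 2, 1, 4] ↔ ∃ a b c d,
    a < b ∧ b < c ∧ c < d ∧ π c < π b ∧ π b < π a ∧ π a < π d := by
  simp only [contains_iff, Fin.forall_fin_succ]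
  simp
  grind

theorem isRect_iff {n : ℕ} {π : Perm (Fin n)} :
    IsRect π ↔ ∀ i j k l, ¬ RectPattern π i j k l := by
  simp only [IsRect, contains_2413, contains_2431, contains_4213, contains_4231, RectPattern]
  constructor
  · rintro ⟨h1, h2, h3, h4⟩ i j k l ⟨hik, hil, hjk, hjl, hki, hil', hlj⟩
    have hij : i ≠ j := by rintro rfl; exact absurd (hil'.trans hlj) (lt_irrefl _)
    have hkl : k ≠ l := by rintro rfl; exact absurd (hki.trans hil') (lt_irrefl _)
    rcases lt_or_gt_of_ne hij with hij | hij <;> rcases lt_or_gt_of_ne hkl with hkl | hkl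
    · exact h1 ⟨i, j, k, l, hij, hjk, hkl, hki, hil', hlj⟩
    · exact h2 ⟨i, j, l, k, hij, hjl, hkl, hki, hil', hlj⟩
    · exact h3 ⟨j, i, k, l, hij, hik, hkl, hki, hil', hlj⟩
    · exact h4 ⟨j, i, l, k, hij, hil, hkl, hki, hil', hlj⟩
  · intro h
    refine ⟨?_, ?_, ?_, ?_⟩ <;> rintro ⟨a, b, c, d, hab, hbc, hcd, h1, h2, h3⟩
    · exact h a b c d ⟨by order, by order, by order, by order, h1, h2, h3⟩
    · exact h a b d c ⟨by order, by order, by order, by order, h1, h2, h3⟩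
    · exact h b a c d ⟨by order, by order, by order, by order, h1, h2, h3⟩
    · exact h b a d c ⟨by order, by order, by order, by order, h1, h2, h3⟩

theorem isEvil_iff {n : ℕ} {π : Perm (Fin n)} :
    IsEvil π ↔ ∀ i j k l, ¬ EvilPattern π i j k l := by
  simp only [IsEvil, contains_2413, contains_4132, contains_4213, contains_3214, EvilPattern]
  constructor
  · rintro ⟨h1, h2, h3, h4⟩ i j k l ⟨hij, hjk, hkl, h | h | h | h⟩
    exacts [h1 ⟨i, j, k, l, hij, hjk, hkl, h⟩, h2 ⟨i, j, k, l, hij, hjk, hkl, h⟩,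
      h3 ⟨i, j, k, l, hij, hjk, hkl, h⟩, h4 ⟨i, j, k, l, hij, hjk, hkl, h⟩]
  · intro h
    refine ⟨?_, ?_, ?_, ?_⟩ <;> rintro ⟨a, b, c, d, hab, hbc, hcd, h'⟩ <;>
      exact h a b c d ⟨hab, hbc, hcd, by tauto⟩

theorem rectPattern_insertion_iff {n : ℕ} {v j : Fin (n + 1)} {π : Perm (Fin n)}
    {a b c d : Fin n} :
    RectPattern (insertion v j π) (j.succAbove a) (j.succAbove b) (j.succAbove c)
      (j.succAbove d) ↔ RectPattern π a b c d := by
  simp [RectPattern]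

theorem evilPattern_insertion_iff {n : ℕ} {v j : Fin (n + 1)} {π : Perm (Fin n)}
    {a b c d : Fin n} :
    EvilPattern (insertion v j π) (j.succAbove a) (j.succAbove b) (j.succAbove c)
      (j.succAbove d) ↔ EvilPattern π a b c d := by
  simp [EvilPattern]

theorem IsRect.of_insertion {n : ℕ} {v j : Fin (n + 1)} {π : Perm (Fin n)}
    (h : IsRect (insertion v j π)) : IsRect π := by
  rw [isRect_iff] at h ⊢
  exact fun a b c d hp => h _ _ _ _ (rectPattern_insertion_iff.2 hp)

theorem IsEvil.of_insertion {n : ℕ} {v j : Fin (n + 1)} {π : Perm (Fin n)}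
    (h : IsEvil (insertion v j π)) : IsEvil π := by
  rw [isEvil_iff] at h ⊢
  exact fun a b c d hp => h _ _ _ _ (evilPattern_insertion_iff.2 hp)

/-- An insertion into a rectangular permutation is rectangular if the new entry takes part in no
occurrence of a pattern. -/
theorem IsRect.insertion {n : ℕ} {v j : Fin (n + 1)} {π : Perm (Fin n)} (h : IsRect π)
    (H : ∀ a b c d, RectPattern (insertion v j π) a b c d → a ≠ j ∧ b ≠ j ∧ c ≠ j ∧ d ≠ j) :
    IsRect (insertion v j π) := by
  rw [isRect_iff] at h ⊢
  intro a b c d hp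
  obtain ⟨ha, hb, hc, hd⟩ := H a b c d hp
  obtain ⟨a, rfl⟩ := Fin.exists_succAbove_eq ha
  obtain ⟨b, rfl⟩ := Fin.exists_succAbove_eq hb
  obtain ⟨c, rfl⟩ := Fin.exists_succAbove_eq hc
  obtain ⟨d, rfl⟩ := Fin.exists_succAbove_eq hd
  exact h a b c d (rectPattern_insertion_iff.1 hp)

/-- An insertion into an evil-avoiding permutation is evil-avoiding if the new entry takes part in
no occurrence of a pattern. -/
theorem IsEvil.insertion {n : ℕ} {v j : Fin (n + 1)} {π : Perm (Fin n)} (h : IsEvil π)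
    (H : ∀ a b c d, EvilPattern (insertion v j π) a b c d → a ≠ j ∧ b ≠ j ∧ c ≠ j ∧ d ≠ j) :
    IsEvil (insertion v j π) := by
  rw [isEvil_iff] at h ⊢
  intro a b c d hp
  obtain ⟨ha, hb, hc, hd⟩ := H a b c d hp
  obtain ⟨a, rfl⟩ := Fin.exists_succAbove_eq ha
  obtain ⟨b, rfl⟩ := Fin.exists_succAbove_eq hb
  obtain ⟨c, rfl⟩ := Fin.exists_succAbove_eq hc
  obtain ⟨d, rfl⟩ := Fin.exists_succAbove_eq hd
  exact h a b c d (evilPattern_insertion_iff.1 hp)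

/-! ### Recoils of an insertion -/

theorem mem_recoils_insertion_self {n : ℕ} (v j : Fin (n + 1)) (π : Perm (Fin n)) :
    v ∈ recoils (insertion v j π) ↔ ∃ w : Fin n, (w : ℕ) = v ∧ (π⁻¹ w).castSucc < j := by
  simp only [recoils, Set.mem_ofPred_eq, insertion_inv, insertion_self]
  constructor
  · rintro ⟨h, hlt⟩
    have hw : (⟨(v : ℕ) + 1, h⟩ : Fin (n + 1)) = v.succAbove ⟨v, by omega⟩ := by
      rw [Fin.succAbove_of_le_castSucc]
      · rfl
      · simp
    rw [hw, insertion_succAbove, Fin.succAbove_lt_iff_castSucc_lt] at hlt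
    exact ⟨_, rfl, hlt⟩
  · rintro ⟨w, hw, hlt⟩
    refine ⟨by omega, ?_⟩
    have hw : (⟨(v : ℕ) + 1, by omega⟩ : Fin (n + 1)) = v.succAbove w := by
      rw [Fin.succAbove_of_le_castSucc]
      · ext; simp [hw]
      · simp [Fin.le_def, hw]
    rwa [hw, insertion_succAbove, Fin.succAbove_lt_iff_castSucc_lt]

theorem mem_recoils_insertion_pred {n : ℕ} (v j : Fin (n + 1)) (π : Perm (Fin n)) {w : Fin n}
    (hw : (w : ℕ) + 1 = v) :
    w.castSucc ∈ recoils (insertion v j π) ↔ j ≤ (π⁻¹ w).castSucc := by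
  have hv : v.succAbove w = w.castSucc :=
    Fin.succAbove_of_castSucc_lt _ _ (by simp [Fin.lt_def]; omega)
  have hv' : (⟨(w.castSucc : ℕ) + 1, by simp⟩ : Fin (n + 1)) = v := by ext; simpa using hw
  simp only [recoils, Set.mem_ofPred_eq, insertion_inv]
  rw [← Fin.lt_succAbove_iff_le_castSucc]
  constructor
  · rintro ⟨_, hlt⟩
    rwa [hv', ← hv, insertion_self, insertion_succAbove] at hlt
  · intro hlt
    refine ⟨by simp, ?_⟩
    rwa [hv', ← hv, insertion_self, insertion_succAbove]

theorem succAbove_mem_recoils_insertion {n : ℕ} (v j : Fin (n + 1)) (π : Perm (Fin n)) {w : Fin n}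
    (hw : (w : ℕ) + 1 ≠ v) :
    v.succAbove w ∈ recoils (insertion v j π) ↔ w ∈ recoils π := by
  simp only [recoils, Set.mem_ofPred_eq, insertion_inv]
  have key : ∀ h : (w : ℕ) + 1 < n, ∀ h' : (v.succAbove w : ℕ) + 1 < n + 1,
      (⟨(v.succAbove w : ℕ) + 1, h'⟩ : Fin (n + 1)) = v.succAbove ⟨w + 1, h⟩ := by
    intro h h'
    ext
    simp only [Fin.succAbove, Fin.lt_def, Fin.val_castSucc]
    split_ifs <;> simp at * <;> omega
  have hlt : (v.succAbove w : ℕ) + 1 < n + 1 ↔ (w : ℕ) + 1 < n := by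
    simp only [Fin.succAbove, Fin.lt_def, Fin.val_castSucc]
    have := v.2
    have := w.2
    split_ifs <;> simp at * <;> omega
  constructor
  · rintro ⟨h, h'⟩
    refine ⟨hlt.1 h, ?_⟩
    rwa [key (hlt.1 h), insertion_succAbove, insertion_succAbove,
      Fin.succAbove_lt_succAbove_iff] at h'
  · rintro ⟨h, h'⟩
    refine ⟨hlt.2 h, ?_⟩
    rwa [key h, insertion_succAbove, insertion_succAbove, Fin.succAbove_lt_succAbove_iff]

open scoped Classical in
theorem recoilCount_eq_sum {n : ℕ} (π : Perm (Fin n)) :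
    recoilCount π = ∑ w, if w ∈ recoils π then 1 else 0 := by
  rw [recoilCount, Set.ncard_eq_toFinset_card', Finset.sum_boole]
  congr 1
  ext; simp

open scoped Classical in
/-- The only recoils that an insertion of the value `v` can create are `v - 1` and `v`, and the
only one that it can destroy is `v - 1`. -/
theorem recoilCount_insertion {n : ℕ} (v j : Fin (n + 1)) (π : Perm (Fin n)) :
    recoilCount (insertion v j π) + (if ∃ w ∈ recoils π, (w : ℕ) + 1 = v then 1 else 0) =
      recoilCount π + (if ∃ w : Fin n, (w : ℕ) + 1 = v ∧ j ≤ (π⁻¹ w).castSucc then 1 else 0) +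
        (if ∃ w : Fin n, (w : ℕ) = v ∧ (π⁻¹ w).castSucc < j then 1 else 0) := by
  have hself : (v ∈ recoils (insertion v j π)) ↔
      ∃ w : Fin n, (w : ℕ) = v ∧ (π⁻¹ w).castSucc < j := mem_recoils_insertion_self v j π
  rw [recoilCount_eq_sum, recoilCount_eq_sum, Fin.sum_univ_succAbove _ v]
  simp only [hself]
  by_cases hv : v = 0
  · subst hv
    rw [Finset.sum_congr rfl fun w _ =>
      if_congr (succAbove_mem_recoils_insertion 0 j π (w := w) (by simp)) rfl rfl]
    simp [add_comm]
  · obtain ⟨w, rfl⟩ := Fin.exists_succ_eq.2 hv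
    have h1 : (∃ w' ∈ recoils π, (w' : ℕ) + 1 = (w.succ : Fin (n + 1))) ↔ w ∈ recoils π := by
      simp [Fin.val_inj]
    have h2 : (∃ w' : Fin n, (w' : ℕ) + 1 = (w.succ : Fin (n + 1)) ∧ j ≤ (π⁻¹ w').castSucc) ↔
        j ≤ (π⁻¹ w).castSucc := by
      simp [Fin.val_inj]
    have h3 : (w.succ.succAbove w ∈ recoils (insertion w.succ j π)) ↔
        j ≤ (π⁻¹ w).castSucc := by
      rw [Fin.succAbove_of_castSucc_lt _ _ Fin.castSucc_lt_succ,
        mem_recoils_insertion_pred _ _ _ (by simp)]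
    rw [if_congr h1 rfl rfl, if_congr h2 rfl rfl, ← Finset.add_sum_erase _ _ (Finset.mem_univ w),
      ← Finset.add_sum_erase (a := w) (s := Finset.univ)
        (f := fun w => if w ∈ recoils π then 1 else 0) (Finset.mem_univ w), if_congr h3 rfl rfl]
    have h4 : ∑ x ∈ Finset.univ.erase w,
        (if w.succ.succAbove x ∈ recoils (insertion w.succ j π) then 1 else 0) =
        ∑ x ∈ Finset.univ.erase w, if x ∈ recoils π then 1 else 0 := by
      refine Finset.sum_congr rfl fun x hx => if_congr ?_ rfl rfl
      refine succAbove_mem_recoils_insertion _ j π fun h => Finset.ne_of_mem_erase hx ?_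
      ext
      simpa using h
    rw [h4]
    ring

/-! ### Rectangular permutations -/

theorem eq_one_or_one_lt {n : ℕ} {x : Fin (n + 2)} (hx : x ≠ 0) : x = 1 ∨ 1 < x := by
  rw [ne_eq, Fin.ext_iff, Fin.val_zero] at hx
  rw [Fin.ext_iff, Fin.lt_def, Fin.val_one]
  omega

theorem RectPattern.ne {n : ℕ} {π : Perm (Fin n)} {i j k l : Fin n} (h : RectPattern π i j k l) :
    i ≠ j := by
  rintro rfl
  exact lt_irrefl _ (h.2.2.2.2.2.1.trans h.2.2.2.2.2.2)

theorem isRect_insertion_zero {n : ℕ} {π : Perm (Fin n)} (h : IsRect π) :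
    IsRect (insertion 0 0 π) := by
  refine h.insertion fun a b c d ⟨hac, had, hbc, hbd, hca, had', hdb⟩ => ?_
  refine ⟨?_, ?_, ?_, ?_⟩ <;> rintro rfl
  · simp at hca
  · simp at hdb
  · simp at hac
  · simp at had

theorem isRect_insertion_one {n : ℕ} {π : Perm (Fin (n + 1))} (h : IsRect π) :
    IsRect (insertion 0 1 π) := by
  refine h.insertion fun a b c d hp => ?_
  have hne := hp.ne
  obtain ⟨hac, had, hbc, hbd, hca, had', hdb⟩ := hp
  have h1 : ∀ x : Fin (n + 2), x < 1 → x = 0 := by simp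
  refine ⟨?_, ?_, ?_, ?_⟩ <;> rintro rfl
  · simp at hca
  · simp at hdb
  · exact hne ((h1 _ hac).trans (h1 _ hbc).symm)
  · exact hne ((h1 _ had).trans (h1 _ hbd).symm)

/-- In an occurrence of a pattern, the first two entries are separated in value by a third one, so
that a new first entry whose value is adjacent to that of its neighbour can be replaced by this
neighbour. -/
theorem isRect_insertion_front {n : ℕ} {π : Perm (Fin (n + 1))} (h : IsRect π)
    {v : Fin (n + 2)} (hv : v = (π 0).castSucc ∨ v = (π 0).succ) :
    IsRect (insertion v 0 π) := by
  have h0 : insertion v 0 π 0 = v := insertion_self _ _ _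
  have h1 : insertion v 0 π 1 = v.succAbove (π 0) := insertion_zero_succ v π 0
  -- no value lies strictly between the first two entries
  have hadj : ∀ x : Fin (n + 2), x ≠ insertion v 0 π 0 → x ≠ insertion v 0 π 1 →
      (x < insertion v 0 π 0 ↔ x < insertion v 0 π 1) := by
    intro x
    rw [h0, h1]
    rcases hv with rfl | rfl
    · simp only [Fin.succAbove_castSucc_self, Fin.lt_def, ne_eq, Fin.ext_iff]
      simp; omega
    · rw [Fin.succAbove_of_castSucc_lt _ _ Fin.castSucc_lt_succ]
      simp only [Fin.lt_def, ne_eq, Fin.ext_iff]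
      simp; omega
  have hno := isRect_iff.1 h
  have key : ∀ a b c d : Fin (n + 2), a ≠ 0 → b ≠ 0 → c ≠ 0 → d ≠ 0 →
      ¬ RectPattern (insertion v 0 π) a b c d := by
    intro a b c d ha hb hc hd hp
    obtain ⟨a, rfl⟩ := Fin.exists_succAbove_eq ha
    obtain ⟨b, rfl⟩ := Fin.exists_succAbove_eq hb
    obtain ⟨c, rfl⟩ := Fin.exists_succAbove_eq hc
    obtain ⟨d, rfl⟩ := Fin.exists_succAbove_eq hd
    exact hno a b c d (rectPattern_insertion_iff.1 hp)
  generalize insertion v 0 π = σ at *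
  rw [isRect_iff]
  intro a b c d hp
  obtain ⟨hac, had, hbc, hbd, hca, had', hdb⟩ := id hp
  have hc : c ≠ 0 := Fin.ne_zero_of_lt hac
  have hd : d ≠ 0 := Fin.ne_zero_of_lt had
  have hσ : ∀ {x y}, x ≠ y → σ x ≠ σ y := fun hxy => σ.injective.ne hxy
  by_cases ha : a = 0
  · subst ha
    by_cases hb : b = 0
    · subst hb
      exact absurd (had'.trans hdb) (lt_irrefl _)
    · rcases eq_one_or_one_lt hb with rfl | hb1
      · have := (hadj (σ d) (hσ hd) (hσ hbd.ne')).2 hdb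
        exact lt_asymm this had'
      · have hc1 := hb1.trans hbc
        have hd1 := hb1.trans hbd
        have e1 := (hadj (σ c) (hσ hc) (hσ hc1.ne')).1 hca
        have e2 := hadj (σ d) (hσ hd) (hσ hd1.ne')
        have e3 : σ 1 < σ d :=
          lt_of_le_of_ne (not_lt.1 fun hh => lt_asymm (e2.2 hh) had') (hσ hd1.ne)
        exact key 1 b c d (by simp) hb hc hd ⟨hc1, hd1, hbc, hbd, e1, e3, hdb⟩
  · by_cases hb : b = 0
    · subst hb
      rcases eq_one_or_one_lt ha with rfl | ha1
      · have := (hadj (σ d) (hσ hd) (hσ had.ne')).1 hdb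
        exact lt_asymm this had'
      · have hc1 := ha1.trans hac
        have hd1 := ha1.trans had
        have e1 := (hadj (σ d) (hσ hd) (hσ hd1.ne')).1 hdb
        exact key a 1 c d ha (by simp) hc hd ⟨hac, had, hc1, hd1, hca, had', e1⟩
    · exact key a b c d ha hb hc hd hp

theorem RectStep.isRect {x : RectLetter} {n : ℕ} {π : Perm (Fin n)} {σ : Perm (Fin (n + 1))}
    (h : RectStep x π σ) : IsRect σ := by
  cases h with
  | one _ h => exact isRect_insertion_zero h
  | two _ h _ => exact isRect_insertion_one h
  | u _ h _ => exact isRect_insertion_front h (Or.inl rfl)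
  | d _ h => exact isRect_insertion_front h (Or.inr rfl)

theorem RectStep.recoilCount_eq {x : RectLetter} {n : ℕ} {π : Perm (Fin n)}
    {σ : Perm (Fin (n + 1))} (h : RectStep x π σ) :
    recoilCount σ = recoilCount π + if x = .d then 1 else 0 := by
  classical
  cases h with
  | one π h => simpa using recoilCount_insertion 0 0 π
  | @two n π h h0 =>
    have := recoilCount_insertion 0 1 π
    have h1 : ∀ w : Fin (n + 1), ¬ ((w : ℕ) = 0 ∧ (π⁻¹ w).castSucc < 1) := by
      rintro w ⟨hw, h1⟩
      have hw0 : w = 0 := by ext; simpa using hw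
      have h2 : π⁻¹ w = 0 := by
        rw [Fin.lt_def] at h1
        ext
        simpa using h1
      rw [hw0, Perm.inv_eq_iff_eq] at h2
      exact h0 h2.symm
    simp only [Fin.val_zero, h1, exists_false] at this
    simpa using this
  | @u n π h h0 =>
    have := recoilCount_insertion (π 0).castSucc 0 π
    have hpos : 0 < ((π 0 : Fin (n + 1)) : ℕ) := Fin.pos_iff_ne_zero.2 h0
    have h1 : ∃ w ∈ recoils π, (w : ℕ) + 1 = ((π 0).castSucc : Fin (n + 2)) := by
      refine ⟨⟨(π 0 : ℕ) - 1, by omega⟩, ⟨by simp; omega, ?_⟩, by simp; omega⟩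
      have e : (⟨((⟨(π 0 : ℕ) - 1, by omega⟩ : Fin (n + 1)) : ℕ) + 1, by simp; omega⟩ :
          Fin (n + 1)) = π 0 := by ext; simp; omega
      rw [e, Perm.inv_def, symm_apply_apply, Fin.pos_iff_ne_zero]
      intro h2
      rw [symm_apply_eq, Fin.ext_iff] at h2
      simp at h2
      omega
    have h2 : ∃ w : Fin (n + 1), (w : ℕ) + 1 = ((π 0).castSucc : Fin (n + 2)) ∧
        0 ≤ (π⁻¹ w).castSucc := ⟨⟨(π 0 : ℕ) - 1, by omega⟩, by simp; omega, Fin.zero_le _⟩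
    rw [if_pos h1, if_pos h2] at this
    simp at this ⊢
    omega
  | @d n π h =>
    have := recoilCount_insertion (π 0).succ 0 π
    have h1 : ¬ ∃ w ∈ recoils π, (w : ℕ) + 1 = ((π 0).succ : Fin (n + 2)) := by
      rintro ⟨w, ⟨_, hw⟩, hw'⟩
      have : w = π 0 := by ext; simpa using hw'
      subst this
      simp at hw
    have h2 : ∃ w : Fin (n + 1), (w : ℕ) + 1 = ((π 0).succ : Fin (n + 2)) ∧
        0 ≤ (π⁻¹ w).castSucc := ⟨π 0, by simp, Fin.zero_le _⟩
    rw [if_neg h1, if_pos h2] at this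
    simpa using this

theorem RectStep.right_unique {x : RectLetter} {n : ℕ} {π : Perm (Fin n)}
    {σ σ' : Perm (Fin (n + 1))} (h : RectStep x π σ) (h' : RectStep x π σ') : σ = σ' := by
  cases h <;> cases h' <;> rfl

theorem RectStep.eq_one_iff {x : RectLetter} {n : ℕ} {π : Perm (Fin n)} {σ : Perm (Fin (n + 1))}
    (h : RectStep x π σ) : x = .one ↔ σ 0 = 0 := by
  cases h with
  | one _ h => simp
  | two π h h0 =>
    have h1 : insertion 0 1 π 0 = (π 0).succ := by simpa using insertion_succAbove 0 1 π 0
    rw [h1]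
    simp
  | u _ h h0 =>
    simp only [reduceCtorEq, insertion_self, false_iff]
    exact fun h => h0 (Fin.ext (by simpa using congrArg Fin.val h))
  | d _ h => simp

/-- The letter of the step that leads to `σ`, as read off from the first two entries of `σ`. -/
theorem RectStep.letter_iff {x : RectLetter} {n : ℕ} {π : Perm (Fin (n + 1))}
    {σ : Perm (Fin (n + 2))} (h : RectStep x π σ) :
    (x = .one ↔ (σ 0 : ℕ) = 0) ∧ (x = .two ↔ (σ 1 : ℕ) = 0 ∧ 1 < (σ 0 : ℕ)) ∧
      (x = .u ↔ (σ 0 : ℕ) ≠ 0 ∧ (σ 1 : ℕ) = σ 0 + 1) ∧ (x = .d ↔ (σ 0 : ℕ) = σ 1 + 1) := by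
  have h1 : ∀ v, insertion v 0 π 1 = v.succAbove (π 0) := fun v => insertion_zero_succ v π 0
  cases h with
  | one _ h =>
    rw [insertion_self, h1, Fin.succAbove_zero, Fin.val_succ, Fin.val_zero]
    grind
  | two _ h h0 =>
    have h1 : insertion 0 1 π 0 = (π 0).succ := by simpa using insertion_succAbove 0 1 π 0
    have : 0 < ((π 0 : Fin (n + 1)) : ℕ) := Fin.pos_iff_ne_zero.2 h0
    rw [insertion_self, h1, Fin.val_succ, Fin.val_zero]
    grind
  | u _ h h0 =>
    have : 0 < ((π 0 : Fin (n + 1)) : ℕ) := Fin.pos_iff_ne_zero.2 h0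
    rw [insertion_self, h1, Fin.succAbove_castSucc_self, Fin.val_succ, Fin.val_castSucc]
    grind
  | d _ h =>
    rw [insertion_self, h1, Fin.succAbove_of_castSucc_lt _ _ Fin.castSucc_lt_succ, Fin.val_succ,
      Fin.val_castSucc]
    grind

theorem RectStep.left_unique {x x' : RectLetter} {n : ℕ} {π π' : Perm (Fin n)}
    {σ : Perm (Fin (n + 1))} (h : RectStep x π σ) (h' : RectStep x' π' σ) : x = x' ∧ π = π' := by
  have hx : x = x' := by
    cases n with
    | zero => rw [h.eq_one_iff.2 (Fin.eq_zero _), h'.eq_one_iff.2 (Fin.eq_zero _)]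
    | succ n =>
      have h1 := h.letter_iff
      have h2 := h'.letter_iff
      cases x
      · exact (h2.1.2 (h1.1.1 rfl)).symm
      · exact (h2.2.1.2 (h1.2.1.1 rfl)).symm
      · exact (h2.2.2.1.2 (h1.2.2.1.1 rfl)).symm
      · exact (h2.2.2.2.2 (h1.2.2.2.1 rfl)).symm
  subst hx
  refine ⟨rfl, ?_⟩
  generalize hσ : σ = τ at h'
  cases h <;> cases h' <;> exact insertion_eq_insertion hσ

theorem exists_rectStep {n : ℕ} {σ : Perm (Fin (n + 1))} (h : IsRect σ) :
    ∃ (x : RectLetter) (π : Perm (Fin n)), RectStep x π σ := by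
  by_cases h0 : σ 0 = 0
  · obtain ⟨π, hπ⟩ := exists_insertion_eq σ 0
    rw [h0] at hπ
    subst hπ
    exact ⟨.one, π, .one π h.of_insertion⟩
  cases n with
  | zero => exact absurd (Fin.eq_zero (σ 0)) h0
  | succ n =>
    have hno := isRect_iff.1 h
    have hpos : 0 < ((σ 0 : Fin (n + 2)) : ℕ) := Fin.pos_iff_ne_zero.2 h0
    have h2 : ∀ v : Fin (n + 2), v ≠ σ 0 → v ≠ σ 1 → 0 < σ⁻¹ v ∧ 1 < σ⁻¹ v := by
      intro v hv0 hv1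
      have e0 : σ⁻¹ v ≠ 0 := fun he => hv0 (by rw [← he]; simp)
      have e1 : σ⁻¹ v ≠ 1 := fun he => hv1 (by rw [← he]; simp)
      exact ⟨Fin.pos_iff_ne_zero.2 e0, (eq_one_or_one_lt e0).resolve_left e1⟩
    obtain ⟨π, hπ⟩ := exists_insertion_eq σ 0
    have h10 : σ 1 = (σ 0).succAbove (π 0) := by
      conv_lhs => rw [← hπ]
      exact insertion_zero_succ _ π 0
    obtain hd | hd := eq_or_ne (σ 0 : ℕ) (σ 1 + 1)
    · have e : σ 0 = (π 0).succ := by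
        rw [Fin.succAbove] at h10
        rw [Fin.ext_iff] at h10 ⊢
        split_ifs at h10 with hlt <;> simp [Fin.lt_def] at h10 hlt ⊢ <;> omega
      rw [e] at hπ
      subst hπ
      exact ⟨.d, π, .d π h.of_insertion⟩
    obtain hu | hu := eq_or_ne (σ 1 : ℕ) (σ 0 + 1)
    · have e : σ 0 = (π 0).castSucc := by
        rw [Fin.succAbove] at h10
        rw [Fin.ext_iff] at h10 ⊢
        split_ifs at h10 with hlt <;> simp [Fin.lt_def] at h10 hlt ⊢ <;> omega
      have e' : π 0 ≠ 0 := by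
        intro h'
        rw [h'] at e
        exact h0 e
      rw [e] at hπ
      subst hπ
      exact ⟨.u, π, .u π h.of_insertion e'⟩
    clear h10 hπ π
    have hne : (σ 1 : ℕ) ≠ σ 0 := fun h => absurd (σ.injective (Fin.ext h)) (by simp)
    -- otherwise `0` and the neighbour of `σ 0` on the side of `σ 1` complete a pattern
    have h1 : σ 1 = 0 := by
      by_contra h1
      have hpos1 : 0 < ((σ 1 : Fin (n + 2)) : ℕ) := Fin.pos_iff_ne_zero.2 h1
      obtain ⟨z0, z1⟩ := h2 0 (Ne.symm h0) (Ne.symm h1)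
      rcases lt_or_gt_of_ne hne with hlt | hlt
      · obtain ⟨w0, w1⟩ := h2 ⟨(σ 0 : ℕ) - 1, by omega⟩ (by rw [ne_eq, Fin.ext_iff]; simp; omega)
          (by rw [ne_eq, Fin.ext_iff]; simp; omega)
        refine hno 1 0 _ _ ⟨z1, w1, z0, w0, ?_, ?_, ?_⟩ <;>
          simp only [Perm.inv_def, apply_symm_apply, Fin.lt_def, Fin.val_zero] <;> omega
      · obtain ⟨w0, w1⟩ := h2 ⟨(σ 0 : ℕ) + 1, by omega⟩ (by rw [ne_eq, Fin.ext_iff]; simp)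
          (by rw [ne_eq, Fin.ext_iff]; simp; omega)
        refine hno 0 1 _ _ ⟨z0, w0, z1, w1, ?_, ?_, ?_⟩ <;>
          simp only [Perm.inv_def, apply_symm_apply, Fin.lt_def, Fin.val_zero] <;> omega
    obtain ⟨π, hπ⟩ := exists_insertion_eq σ 1
    rw [h1] at hπ
    refine ⟨.two, π, hπ ▸ .two π (IsRect.of_insertion (hπ ▸ h)) fun h' => hd ?_⟩
    have : σ 0 = (π 0).succ := by
      rw [← hπ]
      simpa using insertion_succAbove 0 1 π 0
    rw [this, h1, h']
    simp

/-! ### Sandwiched permutations -/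

theorem val_succAbove {n : ℕ} (v : Fin (n + 1)) (k : Fin n) :
    (v.succAbove k : ℕ) = if (k : ℕ) < v then (k : ℕ) else k + 1 := by
  simp only [Fin.succAbove, Fin.lt_def, Fin.val_castSucc]
  split_ifs <;> rfl

theorem eq_of_val_apply_eq {n : ℕ} {σ : Perm (Fin n)} {x y : Fin n} (h : (σ x : ℕ) = σ y) :
    (x : ℕ) = y :=
  congrArg Fin.val (σ.injective (Fin.ext h))

theorem exists_val_apply_eq {n : ℕ} (σ : Perm (Fin n)) {v : ℕ} (hv : v < n) :
    ∃ x, (σ x : ℕ) = v :=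
  ⟨σ.symm ⟨v, hv⟩, by simp⟩

theorem endsWithIdentity_iff {n : ℕ} {π : Perm (Fin n)} :
    EndsWithIdentity π ↔ ∃ t, Sandwiched 0 t π := by
  simp [EndsWithIdentity, Sandwiched]

/-- An occurrence of a pattern does not meet an initial segment of fixed points, because some later
entry of the occurrence is smaller than its first entry. -/
theorem EvilPattern.le_of_prefix {n a : ℕ} {σ : Perm (Fin n)} {i j k l : Fin n}
    (hp : EvilPattern σ i j k l) (hpre : ∀ x : Fin n, (x : ℕ) < a → (σ x : ℕ) = x) :
    a ≤ (i : ℕ) := by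
  by_contra! hi
  have key : ∀ x : Fin n, i < x → ¬ σ x < σ i := by
    intro x hix hlt
    rw [Fin.lt_def] at hix hlt
    have e := hpre i hi
    have e' := hpre (σ x) (by omega)
    have := eq_of_val_apply_eq e'
    omega
  obtain ⟨hij, hjk, hkl, h | h | h | h⟩ := hp
  · exact key k (hij.trans hjk) h.1
  · exact key k (hij.trans hjk) h.2.2
  · exact key k (hij.trans hjk) (h.1.trans (h.2.1.trans h.2.2))
  · exact key k (hij.trans hjk) (h.1.trans h.2.1)

/-- An occurrence of a pattern in an `(a, b)`-sandwiched permutation lies between the two sorted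
blocks. -/
theorem EvilPattern.mem_middle {n a b : ℕ} {σ : Perm (Fin n)} {i j k l : Fin n}
    (hp : EvilPattern σ i j k l) (hs : Sandwiched a b σ) : a ≤ (i : ℕ) ∧ (l : ℕ) < n - b := by
  obtain ⟨hb, hab, hpre, hsuf⟩ := hs
  have hi := hp.le_of_prefix hpre
  refine ⟨hi, ?_⟩
  by_contra! hl
  have el := hsuf l hl
  have hln := l.2
  -- smaller entries to the left of `l` belong to the last block as well
  have key : ∀ x y : Fin n, i ≤ x → x < y → y < l → σ x < σ l → σ x < σ y ∧ σ y < σ l := by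
    intro x y hix hxy hyl hlt
    rw [Fin.lt_def] at hxy hyl hlt
    rw [Fin.le_def] at hix
    have hx : n - b ≤ (x : ℕ) := by
      by_contra! hx
      rcases lt_or_ge (σ x : ℕ) a with h | h
      · have := eq_of_val_apply_eq (hpre (σ x) h)
        omega
      · have e := hsuf ⟨n - b + (σ x - a), by omega⟩ (by dsimp only; omega)
        have := eq_of_val_apply_eq (σ := σ) (x := x)
          (y := ⟨n - b + (σ x - a), by omega⟩) (by rw [e]; dsimp only; omega)
        dsimp only at this
        omega
    have ex := hsuf x hx
    have ey := hsuf y (by omega)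
    constructor <;> rw [Fin.lt_def] <;> omega
  obtain ⟨hij, hjk, hkl, h | h | h | h⟩ := hp
  · exact lt_asymm h.2.2 (key i j le_rfl hij (hjk.trans hkl) h.2.1).2
  · exact lt_asymm h.2.1 (key j k hij.le hjk hkl h.1).2
  · exact lt_asymm h.1 (key j k hij.le hjk hkl h.2.1).1
  · exact lt_asymm h.1 (key j k hij.le hjk hkl (h.2.1.trans h.2.2)).1

theorem isEvil_insertion_zero {n : ℕ} {π : Perm (Fin n)} (h : IsEvil π) :
    IsEvil (insertion 0 0 π) := by
  refine h.insertion fun i j k l hp => ?_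
  have h1 := hp.le_of_prefix (a := 1) fun x hx => by
    have : x = 0 := by ext; simpa using hx
    simp [this]
  obtain ⟨hij, hjk, hkl, -⟩ := hp
  rw [Fin.lt_def] at hij hjk hkl
  simp only [ne_eq, Fin.ext_iff, Fin.val_zero]
  omega

theorem IsEvil.insertion_last {n b : ℕ} {v : Fin (n + 1)} {π : Perm (Fin n)} (h : IsEvil π)
    (hs : Sandwiched 0 b (RectEvil.insertion v (Fin.last n) π)) :
    IsEvil (RectEvil.insertion v (Fin.last n) π) := by
  refine h.insertion fun i j k l hp => ?_
  have h1 := (hp.mem_middle hs).2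
  have hb := hs.1
  obtain ⟨hij, hjk, hkl, -⟩ := hp
  rw [Fin.lt_def] at hij hjk hkl
  simp only [ne_eq, Fin.ext_iff, Fin.val_last]
  omega

theorem sandwiched_insertion_last_zero {n : ℕ} (π : Perm (Fin n)) :
    Sandwiched 0 1 (insertion 0 (Fin.last n) π) := by
  refine ⟨one_pos, by omega, by simp, fun i hi => ?_⟩
  have : i = Fin.last n := by ext; simp; omega
  subst this
  simp

theorem Sandwiched.val_last {n a b : ℕ} {π : Perm (Fin (n + 1))} (hs : Sandwiched a b π) :
    (π (Fin.last n) : ℕ) + 1 = a + b := by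
  obtain ⟨hb, hab, hpre, hsuf⟩ := hs
  have := hsuf (Fin.last n) (by simp; omega)
  simp only [Fin.val_last] at this
  omega

theorem Sandwiched.insertion_last {n t : ℕ} {π : Perm (Fin (n + 1))} (hs : Sandwiched 0 t π) :
    Sandwiched 0 (t + 1) (insertion (π (Fin.last n)).succ (Fin.last (n + 1)) π) := by
  have hl := hs.val_last
  obtain ⟨hb, hab, hpre, hsuf⟩ := hs
  refine ⟨by omega, by omega, by simp, fun i hi => ?_⟩
  induction i using Fin.lastCases with
  | last => simp; omega
  | cast i =>
    have := hsuf i (by simp at hi; omega)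
    have hi' := i.2
    rw [insertion_last_castSucc, val_succAbove, this]
    simp
    omega

theorem Sandwiched.of_insertion_last {n t : ℕ} {v : Fin (n + 2)} {π : Perm (Fin (n + 1))}
    (ht : 0 < t) (hs : Sandwiched 0 (t + 1) (insertion v (Fin.last (n + 1)) π)) :
    Sandwiched 0 t π := by
  have hl := hs.val_last
  obtain ⟨hb, hab, hpre, hsuf⟩ := hs
  refine ⟨by omega, by omega, by simp, fun i hi => ?_⟩
  have := hsuf i.castSucc (by simp; omega)
  have hi' := i.2
  rw [insertion_last_castSucc, val_succAbove] at this
  rw [insertion_self] at hl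
  simp at this
  split_ifs at this <;> omega

/-! ### The least recoil -/

/-- Values that do not exceed the least recoil occur in increasing order. -/
theorem lt_of_apply_lt_of_recoils {n t : ℕ} {π : Perm (Fin n)}
    (ht : ∀ w ∈ recoils π, t ≤ (w : ℕ)) {x y : Fin n} (hxy : π x < π y) (hy : (π y : ℕ) ≤ t) :
    x < y := by
  have step : ∀ x y : Fin n, (π y : ℕ) = π x + 1 → (π y : ℕ) ≤ t → x < y := by
    intro x y hxy hy
    by_contra! hle
    have hne : y ≠ x := by rintro rfl; omega
    have : π x ∈ recoils π := by
      refine ⟨by omega, ?_⟩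
      have e : (⟨(π x : ℕ) + 1, by omega⟩ : Fin n) = π y := by ext; exact hxy.symm
      rw [e]
      simpa using lt_of_le_of_ne hle hne
    have := ht _ this
    omega
  have main : ∀ d : ℕ, ∀ y : Fin n, (π y : ℕ) = π x + 1 + d → (π y : ℕ) ≤ t → x < y := by
    intro d
    induction d with
    | zero => exact fun y h h' => step x y h h'
    | succ d ih =>
      intro y h h'
      obtain ⟨z, hz⟩ := exists_val_apply_eq π (v := π x + 1 + d) (by omega)
      exact (ih z hz (by omega)).trans (step z y (by omega) h')
  rw [Fin.lt_def] at hxy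
  exact main (π y - π x - 1) y (by omega) hy

theorem eq_one_of_val_apply_eq {n : ℕ} {π : Perm (Fin n)} (h : ∀ x, (π x : ℕ) = x) : π = 1 :=
  Equiv.ext fun x => Fin.ext (h x)

theorem Sandwiched.lt_of_ne_one {n a b : ℕ} {π : Perm (Fin n)} (hs : Sandwiched a b π)
    (h1 : π ≠ 1) : a + b < n := by
  obtain ⟨hb, hab, hpre, hsuf⟩ := hs
  by_contra! h
  refine h1 (eq_one_of_val_apply_eq fun x => ?_)
  rcases lt_or_ge (x : ℕ) a with hx | hx
  · exact hpre x hx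
  · have := hsuf x (by omega)
    omega

/-- The least recoil of an `(a, b)`-sandwiched permutation other than the identity is its last
entry. -/
theorem Sandwiched.least_recoil {n a b : ℕ} {π : Perm (Fin n)} (hs : Sandwiched a b π)
    (h1 : a + b < n) {t : Fin n} (ht : (t : ℕ) + 1 = a + b) : IsLeast (recoils π) t := by
  obtain ⟨hb, hab, hpre, hsuf⟩ := hs
  have hsuf' : ∀ m, (hm : m < b) → (π ⟨n - b + m, by omega⟩ : ℕ) = a + m := by
    intro m hm
    rw [hsuf _ (by dsimp only; omega)]
    dsimp only
    omega
  have pos : ∀ x : Fin n, (π x : ℕ) < a + b →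
      (x : ℕ) = if (π x : ℕ) < a then (π x : ℕ) else n - b + (π x - a) := by
    intro x hx
    split_ifs with h
    · exact (eq_of_val_apply_eq (hpre (π x) h)).symm
    · have := eq_of_val_apply_eq (σ := π) (x := x) (y := ⟨n - b + (π x - a), by omega⟩)
        (by rw [hsuf' (π x - a) (by omega)]; omega)
      exact this
  constructor
  · refine ⟨by omega, ?_⟩
    obtain ⟨x, hx⟩ := π.surjective t
    obtain ⟨y, hy⟩ := π.surjective ⟨(t : ℕ) + 1, by omega⟩
    rw [← hy, ← hx, Perm.inv_def, symm_apply_apply, symm_apply_apply, Fin.lt_def]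
    rw [Fin.ext_iff] at hx hy
    dsimp only at hy
    have ex := pos x (by omega)
    have hy2 := y.2
    have hne : (x : ℕ) ≠ y := by
      intro h
      rw [Fin.ext h] at hx
      omega
    rw [if_neg (by omega)] at ex
    omega
  · rintro w ⟨hw, hlt⟩
    by_contra! hwt
    rw [Fin.lt_def] at hwt
    obtain ⟨x, hx⟩ := π.surjective w
    obtain ⟨y, hy⟩ := π.surjective ⟨(w : ℕ) + 1, hw⟩
    rw [← hy, ← hx, Perm.inv_def, symm_apply_apply, symm_apply_apply, Fin.lt_def] at hlt
    rw [Fin.ext_iff] at hx hy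
    dsimp only at hy
    have ex := pos x (by omega)
    have ey := pos y (by omega)
    split_ifs at ex ey <;> omega

theorem recoils_one (n : ℕ) : recoils (1 : Perm (Fin n)) = ∅ := by
  ext w
  simp [recoils, Fin.lt_def]

/-! ### The operator `ψ_q` -/

theorem lt_of_apply_lt_of_isLeast {n : ℕ} {π : Perm (Fin n)} {t : Fin n}
    (ht : IsLeast (recoils π) t) {x y : Fin n} (hxy : π x < π y) (hy : π y ≤ t) : x < y :=
  lt_of_apply_lt_of_recoils (fun _ hw => ht.2 hw) hxy hy

/-- Prefixing an evil-avoiding permutation by its least recoil plus one keeps it evil-avoiding. -/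
theorem isEvil_insertion_leastRecoil {n : ℕ} {π : Perm (Fin n)} (h : IsEvil π) {t : Fin n}
    (ht : IsLeast (recoils π) t) : IsEvil (insertion t.succ 0 π) := by
  have hno := isEvil_iff.1 h
  obtain ⟨⟨htn, hpos⟩, -⟩ := id ht
  have hlt : ∀ k, t.succ.succAbove k < t.succ ↔ k ≤ t := by
    intro k
    rw [Fin.succAbove_lt_iff_castSucc_lt, Fin.castSucc_lt_succ_iff]
  have hgt : ∀ k, t.succ < t.succ.succAbove k ↔ t < k := by
    intro k
    rw [Fin.lt_succAbove_iff_le_castSucc, Fin.succ_le_castSucc_iff]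
  refine h.insertion fun i j k l hp => ?_
  obtain ⟨hij, hjk, hkl, hval⟩ := hp
  have hj : j ≠ 0 := Fin.ne_zero_of_lt hij
  have hk : k ≠ 0 := Fin.ne_zero_of_lt hjk
  have hl : l ≠ 0 := Fin.ne_zero_of_lt hkl
  refine ⟨?_, hj, hk, hl⟩
  rintro rfl
  obtain ⟨j, rfl⟩ := Fin.exists_succ_eq.2 hj
  obtain ⟨k, rfl⟩ := Fin.exists_succ_eq.2 hk
  obtain ⟨l, rfl⟩ := Fin.exists_succ_eq.2 hl
  simp only [insertion_self, insertion_zero_succ, Fin.succ_lt_succ_iff,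
    Fin.succAbove_lt_succAbove_iff, hlt, hgt] at hjk hkl hval
  rcases hval with ⟨h1, h2, h3⟩ | ⟨h1, h2, h3⟩ | ⟨h1, h2, h3⟩ | ⟨h1, h2, h3⟩
  · -- the values `t + 1` and `t`, which occur in this order, complete a pattern in `π`
    obtain ⟨z, hz⟩ := π.surjective ⟨(t : ℕ) + 1, htn⟩
    obtain ⟨T, hT⟩ := π.surjective t
    have hpos : z < T := by
      rw [← hz, ← hT] at hpos
      simpa using hpos
    have htz : t < π z := by rw [hz, Fin.lt_def]; simp
    have hzl : π z ≤ π l := by rw [hz, Fin.le_def]; exact h2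
    have hkT : k < T → π k < π T := fun hlt =>
      lt_of_le_of_ne (by rw [hT]; exact h1) (π.injective.ne hlt.ne)
    have hTz : π T < π z := by rw [hT]; exact htz
    rcases eq_or_ne l z with rfl | hlz
    · exact hno j k l T ⟨hjk, hkl, hpos, Or.inr (Or.inl ⟨hkT (hkl.trans hpos), hTz, h3⟩)⟩
    have hzl' : π z < π l := lt_of_le_of_ne hzl (π.injective.ne hlz.symm)
    have hzj : z ≠ j := by rintro rfl; exact lt_asymm h3 hzl'
    have hzk : z ≠ k := by rintro rfl; exact absurd htz (not_lt.2 h1)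
    have hkz : π k < π z := lt_of_le_of_lt h1 htz
    rcases lt_or_gt_of_ne hzj with hzj | hzj
    · exact hno z j k l ⟨hzj, hjk, hkl, Or.inl ⟨hkz, hzl', h3⟩⟩
    rcases lt_or_gt_of_ne hzk with hzk | hzk
    · exact hno j z k l ⟨hzj, hzk, hkl, Or.inr (Or.inr (Or.inl ⟨hkz, hzl', h3⟩))⟩
    · exact hno j k z T ⟨hjk, hzk, hpos,
        Or.inr (Or.inl ⟨hkT (hzk.trans hpos), hTz, hzl'.trans h3⟩)⟩
  · exact lt_asymm hkl (lt_of_apply_lt_of_isLeast ht h2 h3)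
  · exact lt_asymm hjk (lt_of_apply_lt_of_isLeast ht h1 (h2.le.trans h3))
  · exact lt_asymm hjk (lt_of_apply_lt_of_isLeast ht h1 h2)

theorem recoilCount_insertion_leastRecoil {n : ℕ} {π : Perm (Fin n)} {t : Fin n}
    (ht : t ∈ recoils π) : recoilCount (insertion t.succ 0 π) = recoilCount π := by
  classical
  have := recoilCount_insertion t.succ 0 π
  rw [if_pos ⟨t, ht, by simp⟩, if_pos ⟨t, by simp, Fin.zero_le _⟩] at this
  simpa using this

theorem val_cycleIcc {n : ℕ} (i j x : Fin n) :
    (Fin.cycleIcc j i x : ℕ) =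
      if (x : ℕ) < j ∨ (i : ℕ) < x then (x : ℕ) else if x = i then (j : ℕ) else x + 1 := by
  have : NeZero n := ⟨by have := x.2; omega⟩
  rcases lt_or_ge x j with hx | hx
  · rw [Fin.cycleIcc_of_lt hx, if_pos (Or.inl (Fin.lt_def.1 hx))]
  rcases lt_or_ge i x with hx' | hx'
  · rw [Fin.cycleIcc_of_gt hx', if_pos (Or.inr (Fin.lt_def.1 hx'))]
  rw [if_neg (by rw [Fin.le_def] at hx hx'; omega), Fin.cycleIcc_of_le_of_le hx hx']
  split_ifs with h
  · rfl
  · refine Fin.val_add_one_of_lt' ?_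
    have := i.2
    rw [Fin.le_def] at hx'
    rw [Fin.ext_iff] at h
    omega

theorem shift_apply_cycleIcc {n : ℕ} (i j : Fin n) (π : Perm (Fin n)) (x : Fin n) :
    shift i j π (Fin.cycleIcc j i x) = π x := by
  simp [shift]

/-- Moving an entry across entries whose values are not adjacent to it does not change the number
of recoils. -/
theorem recoilCount_shift {n : ℕ} {i j : Fin (n + 1)} (hji : j ≤ i) {π : Perm (Fin (n + 1))}
    (h : ∀ x, j ≤ x → x < i → (π i : ℕ) + 1 < π x) : recoilCount (shift i j π) = recoilCount π := by
  classical
  obtain ⟨ρ, hρ⟩ := exists_insertion_eq π i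
  have hval : ∀ y : Fin n, j ≤ y.castSucc → y.castSucc < i → (π i : ℕ) < ρ y := by
    intro y hy hy'
    have h1 := h y.castSucc hy hy'
    have h2 : π y.castSucc = (π i).succAbove (ρ y) := by
      conv_lhs => rw [← hρ, ← Fin.succAbove_of_castSucc_lt i y hy']
      rw [insertion_succAbove]
    rw [h2, val_succAbove] at h1
    split_ifs at h1 <;> omega
  generalize π i = v at hρ hval
  subst hρ
  rw [shift_insertion v hji]
  have hpos : ∀ w : Fin n, (w : ℕ) ≤ v → (j ≤ (ρ⁻¹ w).castSucc ↔ i ≤ (ρ⁻¹ w).castSucc) := by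
    intro w hw
    refine ⟨fun hjw => ?_, fun hiw => hji.trans hiw⟩
    by_contra! hlt
    have := hval _ hjw hlt
    rw [Perm.inv_def, apply_symm_apply] at this
    omega
  have h1 := recoilCount_insertion v i ρ
  have h2 := recoilCount_insertion v j ρ
  have e1 : (∃ w : Fin n, (w : ℕ) + 1 = v ∧ j ≤ (ρ⁻¹ w).castSucc) ↔
      ∃ w : Fin n, (w : ℕ) + 1 = v ∧ i ≤ (ρ⁻¹ w).castSucc :=
    exists_congr fun w => and_congr_right fun hw => hpos w (by omega)
  have e2 : (∃ w : Fin n, (w : ℕ) = v ∧ (ρ⁻¹ w).castSucc < j) ↔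
      ∃ w : Fin n, (w : ℕ) = v ∧ (ρ⁻¹ w).castSucc < i :=
    exists_congr fun w => and_congr_right fun hw => by
      rw [← not_le, ← not_le, hpos w (by omega)]
  rw [if_congr e1 rfl rfl, if_congr e2 rfl rfl] at h2
  omega

/-- The shape of the images of the `(a, b)`-sandwiched permutations other than the identity under
`ψ_q`: in one-line notation (with values counted from `1`) `σ` reads
`a + b + 1, 1, …, a + 1, …, a + 2, …, a + b`. -/
def Wrapped {n : ℕ} (a b : ℕ) (σ : Perm (Fin (n + 1))) : Prop :=
  0 < b ∧ a + b < n ∧ (σ 0 : ℕ) = a + b ∧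
    (∀ x : Fin (n + 1), 1 ≤ (x : ℕ) → (x : ℕ) ≤ a + 1 → (σ x : ℕ) + 1 = x) ∧
    ∀ x : Fin (n + 1), n + 2 - b ≤ (x : ℕ) → (σ x : ℕ) + (n + 1 - b) = a + x

theorem sandwiched_iff_insertion {n a b : ℕ} {π : Perm (Fin n)} {t : Fin n}
    (hb : 0 < b) (hab : a + b < n) (ht : (t : ℕ) + 1 = a + b) :
    Sandwiched a b π ↔
      (∀ x : Fin (n + 1), 1 ≤ (x : ℕ) → (x : ℕ) ≤ a →
        (insertion t.succ 0 π x : ℕ) + 1 = x) ∧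
      ∀ x : Fin (n + 1), n + 1 - b ≤ (x : ℕ) →
        (insertion t.succ 0 π x : ℕ) + (n + 1 - b) = a + x := by
  constructor
  · rintro ⟨-, -, hpre, hsuf⟩
    constructor
    · intro x hx hxa
      induction x using Fin.cases with
      | zero => simp at hx
      | succ x =>
        rw [Fin.val_succ] at hx hxa
        have := hpre x (by omega)
        rw [insertion_zero_succ, val_succAbove, if_pos (by rw [Fin.val_succ]; omega), this,
          Fin.val_succ]
    · intro x hx
      induction x using Fin.cases with
      | zero => simp at hx; omega
      | succ x =>
        rw [Fin.val_succ] at hx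
        have := hsuf x (by omega)
        have hx2 := x.2
        rw [insertion_zero_succ, val_succAbove, if_pos (by rw [Fin.val_succ]; omega), this,
          Fin.val_succ]
        omega
  · rintro ⟨hpre, hsuf⟩
    refine ⟨hb, by omega, fun x hx => ?_, fun x hx => ?_⟩
    · have := hpre x.succ (by simp) (by rw [Fin.val_succ]; omega)
      rw [insertion_zero_succ, val_succAbove, Fin.val_succ, Fin.val_succ] at this
      split_ifs at this <;> omega
    · have := hsuf x.succ (by rw [Fin.val_succ]; omega)
      have hx2 := x.2
      rw [insertion_zero_succ, val_succAbove, Fin.val_succ, Fin.val_succ] at this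
      split_ifs at this <;> omega

/-- Since the least recoil of an `(a, b)`-sandwiched permutation is its last entry,
`ψ_q` wraps it. -/
theorem sandwiched_iff_wrapped {n a b : ℕ} {π : Perm (Fin n)} {t : Fin n}
    (hb : 0 < b) (hab : a + b < n) (ht : (t : ℕ) + 1 = a + b) {i j : Fin (n + 1)}
    (hi : (i : ℕ) + b = n + 1) (hj : (j : ℕ) = a + 1) :
    Sandwiched a b π ↔ Wrapped a b (shift i j (insertion t.succ 0 π)) := by
  have hji : j ≤ i := by rw [Fin.le_def]; omega
  have hc := val_cycleIcc i j
  have hs := shift_apply_cycleIcc i j (insertion t.succ 0 π)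
  rw [sandwiched_iff_insertion hb hab ht]
  have hcs := (Fin.cycleIcc j i).surjective
  have h0 : insertion t.succ 0 π 0 = t.succ := insertion_self _ _ _
  have h0' : shift i j (insertion t.succ 0 π) 0 = t.succ := by
    have e : Fin.cycleIcc j i 0 = 0 := by
      ext
      rw [hc, if_pos (Or.inl (by rw [hj]; simp))]
    have := hs 0
    rwa [e, h0] at this
  generalize insertion t.succ 0 π = τ at *
  generalize shift i j τ = σ at *
  constructor
  · rintro ⟨hpre, hsuf⟩
    refine ⟨hb, hab, by rw [h0', Fin.val_succ, ht], ?_, ?_⟩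
    · intro y hy hya
      obtain ⟨x, rfl⟩ := hcs y
      have hcx := hc x
      rw [hs]
      split_ifs at hcx with h1 h2
      · have := hpre x
        omega
      · subst h2
        have := hsuf x (by omega)
        omega
      · omega
    · intro y hy
      obtain ⟨x, rfl⟩ := hcs y
      have hcx := hc x
      rw [hs]
      split_ifs at hcx with h1 h2
      · have := hsuf x (by omega)
        omega
      · omega
      · have : (x : ℕ) ≠ i := fun h => h2 (Fin.ext h)
        omega
  · rintro ⟨-, -, -, hpre, hsuf⟩
    constructor
    · intro x hx hxa
      have hcx := hc x
      have := hpre (Fin.cycleIcc j i x)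
      rw [hs] at this
      split_ifs at hcx with h1 h2 <;> omega
    · intro x hx
      have hcx := hc x
      have h1 := hpre (Fin.cycleIcc j i x)
      have h2 := hsuf (Fin.cycleIcc j i x)
      rw [hs] at h1 h2
      split_ifs at hcx with h3 h4
      · omega
      · subst h4
        omega
      · have : (x : ℕ) ≠ i := fun h => h4 (Fin.ext h)
        omega

/-- The values below the first entry of a wrapped permutation occur in increasing order. -/
theorem Wrapped.lt_of_apply_lt {n a b : ℕ} {σ : Perm (Fin (n + 1))} (hw : Wrapped a b σ)
    {x y : Fin (n + 1)} (hxy : σ x < σ y) (hy : σ y < σ 0) : x < y := by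
  obtain ⟨hb, hab, h0, hpre, hsuf⟩ := hw
  have pos : ∀ x : Fin (n + 1), (σ x : ℕ) < a + b →
      (x : ℕ) = if (σ x : ℕ) ≤ a then (σ x : ℕ) + 1 else n + 2 - b + (σ x - (a + 1)) := by
    intro x hx
    split_ifs with h
    · have := hpre ⟨σ x + 1, by omega⟩ (by dsimp only; omega) (by dsimp only; omega)
      exact eq_of_val_apply_eq (σ := σ) (y := ⟨σ x + 1, by omega⟩)
        (by dsimp only at this; omega)
    · have := hsuf ⟨n + 2 - b + (σ x - (a + 1)), by omega⟩ (by dsimp only; omega)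
      exact eq_of_val_apply_eq (σ := σ) (y := ⟨n + 2 - b + (σ x - (a + 1)), by omega⟩)
        (by dsimp only at this; omega)
  rw [Fin.lt_def] at hxy hy ⊢
  have ex := pos x (by omega)
  have ey := pos y (by omega)
  split_ifs at ex ey <;> omega

/-- An occurrence of a pattern in a wrapped permutation does not meet the block `1, …, a + 1`. -/
theorem Wrapped.evilPattern {n a b : ℕ} {σ : Perm (Fin (n + 1))} (hw : Wrapped a b σ)
    {i j k l : Fin (n + 1)} (hp : EvilPattern σ i j k l) :
    (i = 0 ∨ a + 2 ≤ (i : ℕ)) ∧ a + 2 ≤ (j : ℕ) := by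
  have hord : ∀ {x y}, σ x < σ y → σ y < σ 0 → x < y := hw.lt_of_apply_lt
  obtain ⟨hb, hab, h0, hpre, hsuf⟩ := hw
  obtain ⟨hij, hjk, hkl, hval⟩ := hp
  rcases eq_or_ne i 0 with rfl | hi
  · refine ⟨Or.inl rfl, ?_⟩
    rcases hval with ⟨h1, h2, h3⟩ | ⟨h1, h2, h3⟩ | ⟨h1, h2, h3⟩ | ⟨h1, h2, h3⟩
    · by_contra! hj
      have := hpre j (by rw [Fin.lt_def] at hij; simp at hij; omega) (by omega)
      rw [Fin.lt_def] at h1 h2 h3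
      omega
    · exact absurd (hord h2 h3) (lt_asymm hkl)
    · exact absurd (hord h1 (h2.trans h3)) (lt_asymm hjk)
    · exact absurd (hord h1 h2) (lt_asymm hjk)
  · have hi1 : 1 ≤ (i : ℕ) := Fin.pos_iff_ne_zero.2 hi
    have hia : a + 2 ≤ (i : ℕ) := by
      by_contra! hia
      have ei := hpre i hi1 (by omega)
      have key : ∀ x, i < x → ¬ σ x < σ i := by
        intro x hix hlt
        rw [Fin.lt_def] at hix hlt
        have hn := i.2
        have := hpre ⟨σ x + 1, by omega⟩ (by dsimp only; omega) (by dsimp only; omega)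
        have := eq_of_val_apply_eq (σ := σ) (x := x) (y := ⟨σ x + 1, by omega⟩)
          (by dsimp only at this; omega)
        dsimp only at this
        omega
      rcases hval with h | h | h | h
      · exact key k (hij.trans hjk) h.1
      · exact key k (hij.trans hjk) h.2.2
      · exact key k (hij.trans hjk) (h.1.trans (h.2.1.trans h.2.2))
      · exact key k (hij.trans hjk) (h.1.trans h.2.1)
    rw [Fin.lt_def] at hij
    exact ⟨Or.inr hia, by omega⟩

section Sandwich

variable {n a b : ℕ} {π : Perm (Fin n)} {t : Fin n} {i j : Fin (n + 1)}

theorem isEvil_shift (h : IsEvil π) (hs : Sandwiched a b π) (hab : a + b < n)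
    (ht : (t : ℕ) + 1 = a + b) (hi : (i : ℕ) + b = n + 1) (hj : (j : ℕ) = a + 1) :
    IsEvil (shift i j (insertion t.succ 0 π)) := by
  have hw := (sandwiched_iff_wrapped hs.1 hab ht hi hj).1 hs
  have he := isEvil_insertion_leastRecoil h (hs.least_recoil hab ht)
  generalize insertion t.succ 0 π = τ at *
  obtain ⟨ρ, hρ⟩ := exists_insertion_eq τ i
  rw [← hρ] at he
  have hji : j ≤ i := by rw [Fin.le_def]; omega
  have hσ : shift i j τ = insertion (τ i) j ρ := by
    conv_lhs => rw [← hρ]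
    rw [shift_insertion _ hji]
  rw [hσ] at hw ⊢
  refine he.of_insertion.insertion fun i' j' k l hp => ?_
  obtain ⟨h1, h2⟩ := hw.evilPattern hp
  obtain ⟨hij, hjk, hkl, -⟩ := hp
  rw [Fin.lt_def] at hij hjk hkl
  simp only [ne_eq, Fin.ext_iff, Fin.val_zero] at h1 ⊢
  omega

theorem isEvil_of_shift (hs : Sandwiched a b π) (hab : a + b < n)
    (ht : (t : ℕ) + 1 = a + b) (hi : (i : ℕ) + b = n + 1) (hj : (j : ℕ) = a + 1)
    (h : IsEvil (shift i j (insertion t.succ 0 π))) : IsEvil π := by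
  rw [isEvil_iff] at h ⊢
  intro i' j' k l hp
  obtain ⟨h1, h2⟩ := hp.mem_middle hs
  -- entries between the two sorted blocks only move by two positions
  have key : ∀ x : Fin n, a ≤ (x : ℕ) → (x : ℕ) < n - b → ∃ y : Fin (n + 1),
      (y : ℕ) = x + 2 ∧
        shift i j (insertion t.succ 0 π) y = t.succ.succAbove (π x) := by
    intro x hxa hxb
    refine ⟨Fin.cycleIcc j i x.succ, ?_, ?_⟩
    · rw [val_cycleIcc, Fin.val_succ, if_neg (by omega), if_neg]
      rw [Fin.ext_iff, Fin.val_succ]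
      omega
    · rw [shift_apply_cycleIcc, insertion_zero_succ]
  obtain ⟨hij, hjk, hkl, hval⟩ := hp
  rw [Fin.lt_def] at hij hjk hkl
  obtain ⟨i₂, hi₂, ei⟩ := key i' (by omega) (by omega)
  obtain ⟨j₂, hj₂, ej⟩ := key j' (by omega) (by omega)
  obtain ⟨k₂, hk₂, ek⟩ := key k (by omega) (by omega)
  obtain ⟨l₂, hl₂, el⟩ := key l (by omega) (by omega)
  refine h i₂ j₂ k₂ l₂ ⟨?_, ?_, ?_, ?_⟩
  · rw [Fin.lt_def]; omega
  · rw [Fin.lt_def]; omega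
  · rw [Fin.lt_def]; omega
  · simpa only [ei, ej, ek, el, Fin.succAbove_lt_succAbove_iff] using hval

theorem recoilCount_shift_insertion (hs : Sandwiched a b π) (hab : a + b < n)
    (ht : (t : ℕ) + 1 = a + b) (hi : (i : ℕ) + b = n + 1) (hj : (j : ℕ) = a + 1) :
    recoilCount (shift i j (insertion t.succ 0 π)) = recoilCount π := by
  rw [← recoilCount_insertion_leastRecoil (hs.least_recoil hab ht).1]
  have hb := hs.1
  obtain ⟨hpre, hsuf⟩ := (sandwiched_iff_insertion hs.1 hab ht).1 hs
  have h0 : (insertion t.succ 0 π 0 : ℕ) = a + b := by simp [ht]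
  generalize insertion t.succ 0 π = τ at *
  refine recoilCount_shift (by rw [Fin.le_def]; omega) fun x hjx hxi => ?_
  rw [Fin.le_def] at hjx
  rw [Fin.lt_def] at hxi
  have ei := hsuf i (by omega)
  by_contra! hle
  -- all values up to `a + b` occur outside the range of positions crossed by the moved entry
  have hx0 : (τ x : ℕ) ≠ a + b := fun h => by
    have := eq_of_val_apply_eq (h.trans h0.symm)
    rw [Fin.val_zero] at this
    omega
  rcases lt_or_ge (τ x : ℕ) a with h | h
  · have := hpre ⟨τ x + 1, by omega⟩ (by dsimp only; omega) (by dsimp only; omega)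
    have := eq_of_val_apply_eq (σ := τ) (x := x) (y := ⟨τ x + 1, by omega⟩)
      (by dsimp only at this; omega)
    dsimp only at this
    omega
  · have := hsuf ⟨n + 1 - b + (τ x - a), by omega⟩ (by dsimp only; omega)
    have := eq_of_val_apply_eq (σ := τ) (x := x) (y := ⟨n + 1 - b + (τ x - a), by omega⟩)
      (by dsimp only at this; omega)
    dsimp only at this
    omega

end Sandwich

/-! ### Telling the operators on evil-avoiding permutations apart -/

theorem Wrapped.unique {n a b a' b' : ℕ} {σ : Perm (Fin (n + 1))} (h : Wrapped a b σ)
    (h' : Wrapped a' b' σ) : a = a' ∧ b = b' := by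
  have key : ∀ {a b a' b' : ℕ}, Wrapped a b σ → Wrapped a' b' σ → ¬ a < a' := by
    rintro a b a' b' ⟨hb, hab, h0, hpre, hsuf⟩ ⟨hb', hab', h0', hpre', hsuf'⟩ hlt
    have e1 := hpre' ⟨a + 2, by omega⟩ (by dsimp only; omega) (by dsimp only; omega)
    have e2 := hsuf ⟨n + 2 - b, by omega⟩ (by dsimp only; omega)
    dsimp only at e1 e2
    have := eq_of_val_apply_eq (σ := σ) (x := ⟨a + 2, by omega⟩) (y := ⟨n + 2 - b, by omega⟩)
      (by omega)
    dsimp only at this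
    omega
  have h1 := key h h'
  have h2 := key h' h
  have h3 := h.2.2.1
  have h4 := h'.2.2.1
  omega

theorem Wrapped.not_endsWithIdentity {n a b : ℕ} {σ : Perm (Fin (n + 1))} (h : Wrapped a b σ) :
    ¬ EndsWithIdentity σ := by
  rw [endsWithIdentity_iff]
  rintro ⟨t, ht, htn, -, hsuf'⟩
  obtain ⟨hb, hab, h0, hpre, hsuf⟩ := h
  -- the value `0` is at position `1`
  have e1 := hpre ⟨1, by omega⟩ (by dsimp only; omega) (by dsimp only; omega)
  have e2 := hsuf' ⟨n + 1 - t, by omega⟩ (by dsimp only; omega)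
  dsimp only at e1 e2
  have := eq_of_val_apply_eq (σ := σ) (x := ⟨1, by omega⟩) (y := ⟨n + 1 - t, by omega⟩)
    (by omega)
  dsimp only at this
  have e3 := hsuf' ⟨n, by omega⟩ (by dsimp only; omega)
  have e4 : n + 1 - t = 1 := by omega
  rw [e4] at e3
  dsimp only at e3
  have e5 := hsuf' ⟨a + b + 1, by omega⟩ (by dsimp only; omega)
  dsimp only at e5
  have := eq_of_val_apply_eq (σ := σ) (x := 0) (y := ⟨a + b + 1, by omega⟩) (by omega)
  simp at this

/-- The two branches of `ψ_q` have disjoint images. -/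
theorem not_wrapped_insertion {n a b : ℕ} {π : Perm (Fin n)} {t : Fin n}
    (ht : t ∈ recoils π) (hs : ¬ ∃ a b, Sandwiched a b π) :
    ¬ Wrapped a b (insertion t.succ 0 π) := by
  rintro ⟨hb, hab, h0, hpre, hsuf⟩
  rw [insertion_self, Fin.val_succ] at h0
  have hpre' : ∀ x : Fin n, (x : ℕ) < a + 1 → (π x : ℕ) = x := by
    intro x hx
    have := hpre x.succ (by simp) (by simp; omega)
    rw [insertion_zero_succ, val_succAbove, Fin.val_succ, Fin.val_succ] at this
    split_ifs at this <;> omega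
  rcases eq_or_ne b 1 with rfl | hb1
  · obtain ⟨htn, hlt⟩ := ht
    have et : π t = t := Fin.ext (hpre' t (by omega))
    obtain ⟨y, hy⟩ := π.surjective ⟨(t : ℕ) + 1, htn⟩
    have hlt : (y : ℕ) < t := by
      have et' : π⁻¹ t = t := by rw [Perm.inv_def, symm_apply_eq, et]
      rwa [← hy, et', Perm.inv_def, symm_apply_apply, Fin.lt_def] at hlt
    have := hpre' y (by omega)
    rw [Fin.ext_iff] at hy
    dsimp only at hy
    omega
  · refine hs ⟨a + 1, b - 1, by omega, by omega, hpre', fun x hx => ?_⟩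
    have := hsuf x.succ (by simp; omega)
    have hx2 := x.2
    rw [insertion_zero_succ, val_succAbove, Fin.val_succ, Fin.val_succ] at this
    split_ifs at this <;> omega

theorem not_endsWithIdentity_insertion {n : ℕ} {π : Perm (Fin n)} {t : Fin n}
    (hs : ¬ ∃ a b, Sandwiched a b π) : ¬ EndsWithIdentity (insertion t.succ 0 π) := by
  rw [endsWithIdentity_iff]
  rintro ⟨m, hm, hmn, -, hsuf⟩
  have h0 : (insertion t.succ 0 π 0 : ℕ) = t + 1 := by simp
  have hm1 : m ≤ n := by
    by_contra! h
    have := hsuf 0 (by simp; omega)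
    simp at this
  have hmt : m ≤ t + 1 := by
    by_contra! h
    have e := hsuf ⟨n + 1 - m + (t + 1), by omega⟩ (by dsimp only; omega)
    dsimp only at e
    have := eq_of_val_apply_eq (σ := insertion t.succ 0 π) (x := 0)
      (y := ⟨n + 1 - m + (t + 1), by omega⟩) (by omega)
    simp at this
  refine hs ⟨0, m, hm, by omega, by simp, fun x hx => ?_⟩
  have := hsuf x.succ (by simp; omega)
  have hx2 := x.2
  rw [insertion_zero_succ, val_succAbove, Fin.val_succ, Fin.val_succ] at this
  split_ifs at this <;> omega

theorem not_endsWithIdentity_insertion_zero {n : ℕ} {π : Perm (Fin n)} (h1 : π ≠ 1) :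
    ¬ EndsWithIdentity (insertion 0 0 π) := by
  rw [endsWithIdentity_iff]
  rintro ⟨m, hm, hmn, -, hsuf⟩
  have e := hsuf ⟨n + 1 - m, by omega⟩ (by dsimp only; omega)
  have := eq_of_val_apply_eq (σ := insertion 0 0 π) (x := 0)
    (y := ⟨n + 1 - m, by omega⟩) (by rw [e, insertion_self]; simp)
  simp at this
  refine h1 (eq_one_of_val_apply_eq fun x => ?_)
  have := hsuf x.succ (by simp; omega)
  rw [insertion_zero_succ] at this
  simp at this
  omega

/-! ### Evil-avoiding permutations -/

theorem val_add_one_eq_of_isLeast {n a b : ℕ} {π : Perm (Fin n)} {t : Fin n}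
    (ht : IsLeast (recoils π) t) (h1 : π ≠ 1) (hs : Sandwiched a b π) : (t : ℕ) + 1 = a + b := by
  have hab := hs.lt_of_ne_one h1
  have hb := hs.1
  have htt : t = ⟨a + b - 1, by omega⟩ :=
    ht.unique (hs.least_recoil hab (by dsimp only; omega))
  rw [htt]
  dsimp only
  omega

theorem EvilStep.isEvil {x : EvilLetter} {n : ℕ} {π : Perm (Fin n)} {σ : Perm (Fin (n + 1))}
    (h : EvilStep x π σ) : IsEvil σ := by
  cases h with
  | p _ h _ => exact isEvil_insertion_zero h
  | q_plain _ h _ t ht _ => exact isEvil_insertion_leastRecoil h ht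
  | q_sandwiched _ h h1 t ht a b hs i j hi hj =>
    exact isEvil_shift h hs (hs.lt_of_ne_one h1) (val_add_one_eq_of_isLeast ht h1 hs) hi hj
  | r _ h => exact h.insertion_last (sandwiched_insertion_last_zero _)
  | s_zero =>
    rw [isEvil_iff]
    rintro i j k l ⟨hij, -⟩
    exact absurd (Subsingleton.elim (α := Fin 1) i j) hij.ne
  | s_succ _ h hs =>
    obtain ⟨t, hs⟩ := endsWithIdentity_iff.1 hs
    exact h.insertion_last hs.insertion_last

theorem EvilStep.recoilCount_eq {x : EvilLetter} {n : ℕ} {π : Perm (Fin n)}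
    {σ : Perm (Fin (n + 1))} (h : EvilStep x π σ) :
    recoilCount σ = recoilCount π + if x = .r then 1 else 0 := by
  classical
  cases h with
  | p π h _ => simpa using recoilCount_insertion 0 0 π
  | q_plain _ h _ t ht _ => simpa using recoilCount_insertion_leastRecoil ht.1
  | q_sandwiched _ h h1 t ht a b hs i j hi hj =>
    simpa using recoilCount_shift_insertion hs (hs.lt_of_ne_one h1)
      (val_add_one_eq_of_isLeast ht h1 hs) hi hj
  | @r n π h =>
    have := recoilCount_insertion 0 (Fin.last (n + 1)) π
    rw [if_neg (by simp), if_neg (by simp), if_pos ⟨0, by simp, Fin.castSucc_lt_last _⟩] at this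
    simpa using this
  | s_zero π => simpa using recoilCount_insertion 0 0 π
  | @s_succ n π h hs =>
    have := recoilCount_insertion (π (Fin.last n)).succ (Fin.last (n + 1)) π
    have e2 : ¬ ∃ w : Fin (n + 1), (w : ℕ) + 1 = ((π (Fin.last n)).succ : Fin (n + 2)) ∧
        Fin.last (n + 1) ≤ (π⁻¹ w).castSucc := by
      rintro ⟨w, -, hw⟩
      exact absurd (Fin.castSucc_lt_last _) (not_lt.2 hw)
    -- the last entry of `π` is a recoil unless it is the largest value
    have e1 : (∃ w ∈ recoils π, (w : ℕ) + 1 = ((π (Fin.last n)).succ : Fin (n + 2))) ↔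
        ∃ w : Fin (n + 1), (w : ℕ) = ((π (Fin.last n)).succ : Fin (n + 2)) ∧
          (π⁻¹ w).castSucc < Fin.last (n + 1) := by
      constructor
      · rintro ⟨w, ⟨hw, -⟩, hw'⟩
        exact ⟨⟨(w : ℕ) + 1, hw⟩, hw', Fin.castSucc_lt_last _⟩
      · rintro ⟨w, hw, -⟩
        rw [Fin.val_succ] at hw
        refine ⟨π (Fin.last n), ⟨by omega, ?_⟩, by simp⟩
        have e : (⟨(π (Fin.last n) : ℕ) + 1, by omega⟩ : Fin (n + 1)) = w := Fin.ext hw.symm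
        rw [e, Perm.inv_def, symm_apply_apply]
        refine lt_of_le_of_ne (Fin.le_last _) fun h => ?_
        rw [symm_apply_eq] at h
        rw [h] at hw
        omega
    rw [if_neg e2, if_congr e1 rfl rfl] at this
    simp only [reduceCtorEq, if_false]
    omega

theorem Sandwiched.unique {n a b a' b' : ℕ} {π : Perm (Fin n)} (h : Sandwiched a b π)
    (h' : Sandwiched a' b' π) (h1 : π ≠ 1) : a = a' ∧ b = b' := by
  have key : ∀ {a b a' b' : ℕ}, Sandwiched a b π → Sandwiched a' b' π → ¬ a < a' := by
    intro a b a' b' hs hs' hlt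
    have hab := hs.lt_of_ne_one h1
    obtain ⟨hb, -, -, hsuf⟩ := hs
    obtain ⟨hb', hab', hpre', -⟩ := hs'
    have e1 := hpre' ⟨a, by omega⟩ hlt
    have e2 := hsuf ⟨n - b, by omega⟩ le_rfl
    dsimp only at e1 e2
    have := eq_of_val_apply_eq (σ := π) (x := ⟨a, by omega⟩) (y := ⟨n - b, by omega⟩) (by omega)
    dsimp only at this
    omega
  have h2 := key h h'
  have h3 := key h' h
  cases n with
  | zero => exact absurd (Subsingleton.elim _ _) h1
  | succ n =>
    have h4 := h.val_last
    have h5 := h'.val_last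
    omega

theorem EvilStep.right_unique {x : EvilLetter} {n : ℕ} {π : Perm (Fin n)}
    {σ σ' : Perm (Fin (n + 1))} (h : EvilStep x π σ) (h' : EvilStep x π σ') : σ = σ' := by
  cases h with
  | p _ _ _ => cases h'; rfl
  | q_plain _ _ _ t ht hs =>
    cases h' with
    | q_plain _ _ _ t' ht' _ => rw [ht.unique ht']
    | q_sandwiched _ _ _ _ _ a b hs' => exact absurd ⟨a, b, hs'⟩ hs
  | q_sandwiched _ _ h1 t ht a b hs i j hi hj =>
    cases h' with
    | q_plain _ _ _ _ _ hs' => exact absurd ⟨a, b, hs⟩ hs'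
    | q_sandwiched _ _ _ t' ht' a' b' hs' i' j' hi' hj' =>
      obtain ⟨rfl, rfl⟩ := hs.unique hs' h1
      obtain rfl : i = i' := Fin.ext (by omega)
      obtain rfl : j = j' := Fin.ext (by omega)
      rw [ht.unique ht']
  | r _ _ => cases h'; rfl
  | s_zero _ => cases h'; rfl
  | s_succ _ _ _ => cases h'; rfl

theorem EvilStep.eq_r_or_eq_s_iff {x : EvilLetter} {n : ℕ} {π : Perm (Fin n)}
    {σ : Perm (Fin (n + 1))} (h : EvilStep x π σ) : x = .r ∨ x = .s ↔ EndsWithIdentity σ := by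
  cases h with
  | p _ h h1 => simpa using not_endsWithIdentity_insertion_zero h1
  | q_plain _ h _ t ht hs => simpa using not_endsWithIdentity_insertion hs
  | q_sandwiched _ h h1 t ht a b hs i j hi hj =>
    simpa using ((sandwiched_iff_wrapped hs.1 (hs.lt_of_ne_one h1)
      (val_add_one_eq_of_isLeast ht h1 hs) hi hj).1 hs).not_endsWithIdentity
  | r _ h => simpa using endsWithIdentity_iff.2 ⟨1, sandwiched_insertion_last_zero _⟩
  | s_zero =>
    exact iff_of_true (Or.inr rfl) (endsWithIdentity_iff.2 ⟨1, sandwiched_insertion_last_zero _⟩)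
  | s_succ _ h hs =>
    obtain ⟨t, hs⟩ := endsWithIdentity_iff.1 hs
    simpa using endsWithIdentity_iff.2 ⟨t + 1, hs.insertion_last⟩

theorem EvilStep.eq_p_iff {x : EvilLetter} {n : ℕ} {π : Perm (Fin n)}
    {σ : Perm (Fin (n + 1))} (h : EvilStep x π σ) (hx : x = .p ∨ x = .q) : x = .p ↔ σ 0 = 0 := by
  cases h with
  | p _ h h1 => simp
  | q_plain _ h _ t ht hs => simp
  | q_sandwiched _ h h1 t ht a b hs i j hi hj =>
    have := ((sandwiched_iff_wrapped hs.1 (hs.lt_of_ne_one h1)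
      (val_add_one_eq_of_isLeast ht h1 hs) hi hj).1 hs).2.2.1
    have hb := hs.1
    simp only [reduceCtorEq, false_iff]
    rw [Fin.ext_iff, Fin.val_zero]
    omega
  | r _ h => simp at hx
  | s_zero => simp at hx
  | s_succ _ h hs => simp at hx

theorem EvilStep.eq_r_iff {x : EvilLetter} {n : ℕ} {π : Perm (Fin n)}
    {σ : Perm (Fin (n + 1))} (h : EvilStep x π σ) (hx : x = .r ∨ x = .s) :
    x = .r ↔ σ (Fin.last n) = 0 ∧ 0 < n := by
  cases h with
  | p _ h h1 => simp at hx
  | q_plain _ h _ t ht hs => simp at hx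
  | q_sandwiched _ h h1 t ht a b hs i j hi hj => simp at hx
  | r _ h => simp
  | s_zero => simp
  | s_succ _ h hs => simp

theorem EvilStep.letter_unique {x x' : EvilLetter} {n : ℕ} {π π' : Perm (Fin n)}
    {σ : Perm (Fin (n + 1))} (h : EvilStep x π σ) (h' : EvilStep x' π' σ) : x = x' := by
  have h1 := h.eq_r_or_eq_s_iff.trans h'.eq_r_or_eq_s_iff.symm
  have h2 := fun hx hx' => (h.eq_p_iff hx).trans (h'.eq_p_iff hx').symm
  have h3 := fun hx hx' => (h.eq_r_iff hx).trans (h'.eq_r_iff hx').symm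
  clear h h'
  cases x <;> cases x' <;> simp_all

theorem shift_injective {n : ℕ} (i j : Fin n) : Function.Injective (shift i j) :=
  fun _ _ h => mul_right_cancel h

/-- The two branches in the definition of `ψ_q` as one alternative. -/
theorem EvilStep.q_cases {n : ℕ} {π : Perm (Fin n)} {σ : Perm (Fin (n + 1))}
    (h : EvilStep .q π σ) : ∃ t, IsLeast (recoils π) t ∧
      (((¬ ∃ a b, Sandwiched a b π) ∧ (¬ ∃ a b, Wrapped a b σ) ∧ σ = insertion t.succ 0 π) ∨
      ∃ (a b : ℕ) (i j : Fin (n + 1)), Sandwiched a b π ∧ Wrapped a b σ ∧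
        (i : ℕ) + b = n + 1 ∧ (j : ℕ) = a + 1 ∧ σ = shift i j (insertion t.succ 0 π)) := by
  cases h with
  | q_plain _ h _ t ht hs =>
    exact ⟨t, ht, Or.inl ⟨hs, fun ⟨a, b, hw⟩ => not_wrapped_insertion ht.1 hs hw, rfl⟩⟩
  | q_sandwiched _ h h1 t ht a b hs i j hi hj =>
    exact ⟨t, ht, Or.inr ⟨a, b, i, j, hs, (sandwiched_iff_wrapped hs.1 (hs.lt_of_ne_one h1)
      (val_add_one_eq_of_isLeast ht h1 hs) hi hj).1 hs, hi, hj, rfl⟩⟩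

theorem EvilStep.left_unique {x x' : EvilLetter} {n : ℕ} {π π' : Perm (Fin n)}
    {σ : Perm (Fin (n + 1))} (h : EvilStep x π σ) (h' : EvilStep x' π' σ) : x = x' ∧ π = π' := by
  have hx := h.letter_unique h'
  subst hx
  refine ⟨rfl, ?_⟩
  by_cases hq : x = .q
  · subst hq
    obtain ⟨t, ht, ⟨hs, hw, rfl⟩ | ⟨a, b, i, j, hs, hw, hi, hj, rfl⟩⟩ := h.q_cases <;>
    obtain ⟨t', ht', ⟨hs', hw', e⟩ | ⟨a', b', i', j', hs', hw', hi', hj', e⟩⟩ := h'.q_cases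
    · exact insertion_eq_insertion e
    · exact absurd ⟨a', b', hw'⟩ hw
    · exact absurd ⟨a, b, hw⟩ hw'
    · obtain ⟨rfl, rfl⟩ := hw.unique hw'
      obtain rfl : i = i' := Fin.ext (by omega)
      obtain rfl : j = j' := Fin.ext (by omega)
      exact insertion_eq_insertion (shift_injective _ _ e)
  generalize hσ : σ = τ at h'
  cases h <;> cases h' <;>
    first | exact absurd rfl hq | exact Subsingleton.elim _ _ | exact insertion_eq_insertion hσ

/-- If the values below `V` occur in increasing order, then neighbouring entries below `V` are
consecutive. -/
theorem apply_succ_of_increasing {n V : ℕ} {σ : Perm (Fin n)}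
    (hord : ∀ x y, σ x < σ y → (σ y : ℕ) < V → x < y) {x y : Fin n} (hxy : (y : ℕ) = x + 1)
    (hx : (σ x : ℕ) < V) (hy : (σ y : ℕ) < V) : (σ y : ℕ) = σ x + 1 := by
  have hlt : σ x < σ y := by
    by_contra! hle
    have hne : σ y ≠ σ x := σ.injective.ne (by rintro rfl; omega)
    have := hord y x (lt_of_le_of_ne hle hne) hx
    rw [Fin.lt_def] at this
    omega
  rw [Fin.lt_def] at hlt
  by_contra hne
  obtain ⟨z, hz⟩ := exists_val_apply_eq σ (v := σ x + 1) (by omega)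
  have h1 := hord x z (by rw [Fin.lt_def]; omega) (by omega)
  have h2 := hord z y (by rw [Fin.lt_def]; omega) (by omega)
  rw [Fin.lt_def] at h1 h2
  omega

/-- If the values below `V` occur in increasing order and the positions from `p` to `q` hold such
values, the first of them `0`, then the entries there are `0, 1, 2, …`. -/
theorem apply_eq_sub_of_increasing {n V p q : ℕ} {σ : Perm (Fin n)}
    (hord : ∀ x y, σ x < σ y → (σ y : ℕ) < V → x < y)
    (hlt : ∀ x : Fin n, p ≤ (x : ℕ) → (x : ℕ) ≤ q → (σ x : ℕ) < V)
    (hp : ∀ x : Fin n, (x : ℕ) = p → (σ x : ℕ) = 0) (x : Fin n) (hpx : p ≤ (x : ℕ))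
    (hxq : (x : ℕ) ≤ q) : (σ x : ℕ) = x - p := by
  have main : ∀ d, ∀ x : Fin n, (x : ℕ) = p + d → (x : ℕ) ≤ q → (σ x : ℕ) = d := by
    intro d
    induction d with
    | zero => exact fun x hx _ => hp x hx
    | succ d ih =>
      intro x hx hxq
      have e := ih ⟨p + d, by omega⟩ rfl (by dsimp only; omega)
      have := apply_succ_of_increasing hord (x := ⟨p + d, by omega⟩) (y := x)
        (by dsimp only; omega) (hlt _ (by dsimp only; omega) (by dsimp only; omega))
        (hlt x (by omega) hxq)
      omega
  exact main _ x (by omega) hxq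

/-- In an evil-avoiding permutation that does not end with its smallest values in increasing
order, the values below the first entry occur in increasing order. -/
theorem IsEvil.lt_of_apply_lt {n : ℕ} {σ : Perm (Fin (n + 1))} (h : IsEvil σ)
    (hE : ¬ EndsWithIdentity σ) {x y : Fin (n + 1)} (hxy : σ x < σ y) (hy : σ y < σ 0) :
    x < y := by
  by_contra hnot
  have hno := isEvil_iff.1 h
  have hne : (recoils σ).Nonempty := by
    by_contra! he
    exact hnot (lt_of_apply_lt_of_recoils (t := n) (by simp [he]) hxy (by omega))
  obtain ⟨w, ⟨hwn, hw⟩, hmin⟩ : ∃ w, IsLeast (recoils σ) w := by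
    obtain ⟨w, hw, hmin⟩ := wellFounded_lt.has_min (recoils σ) hne
    exact ⟨w, hw, fun v hv => not_lt.1 (hmin v hv)⟩
  have hwy : (w : ℕ) < σ y := by
    by_contra! hle
    exact hnot (lt_of_apply_lt_of_recoils (t := w) (fun v hv => hmin hv) hxy hle)
  have hord : ∀ x y, σ x < σ y → (σ y : ℕ) < w + 1 → x < y := fun x y h h' =>
    lt_of_apply_lt_of_recoils (t := w) (fun v hv => hmin hv) h (by omega)
  obtain ⟨P, hP⟩ := σ.surjective ⟨(w : ℕ) + 1, hwn⟩
  obtain ⟨X, hX⟩ := σ.surjective w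
  obtain ⟨Z, hZ⟩ := exists_val_apply_eq σ (v := 0) (by omega)
  have hPX : P < X := by
    rw [← hP, ← hX] at hw
    simpa using hw
  rw [Fin.ext_iff] at hP hX
  dsimp only at hP
  rw [Fin.lt_def] at hy
  have hP0 : 0 < P := Fin.pos_iff_ne_zero.2 (by rintro rfl; omega)
  -- a smaller value to the left of `w + 1` completes the pattern `4132` with `σ 0`, `w + 1`, `w`
  have hPZ : P < Z := by
    by_contra! hle
    have hne : Z ≠ P := by rintro rfl; omega
    have hZP : Z < P := lt_of_le_of_ne hle hne
    have hZ0 : 0 < Z := Fin.pos_iff_ne_zero.2 (by rintro rfl; omega)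
    have hw0 : (w : ℕ) ≠ 0 := by
      intro h0
      have := eq_of_val_apply_eq (σ := σ) (x := X) (y := Z) (by omega)
      rw [Fin.lt_def] at hPX hZP
      omega
    refine hno 0 Z P X ⟨hZ0, hZP, hPX, Or.inr (Or.inl ⟨?_, ?_, ?_⟩)⟩ <;> rw [Fin.lt_def] <;> omega
  -- an entry above `w` to the right of the value `0` completes a pattern `4213` or `3214` with
  -- `σ 0`, `w + 1` and `0`
  have hlt : ∀ z : Fin (n + 1), (Z : ℕ) ≤ z → (z : ℕ) ≤ n → (σ z : ℕ) < w + 1 := by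
    intro z hz _
    by_contra! hle
    have hzZ : Z < z := by
      refine lt_of_le_of_ne hz ?_
      rintro rfl
      omega
    have hne : (σ z : ℕ) ≠ σ P := fun h => by
      have := eq_of_val_apply_eq h
      rw [Fin.lt_def] at hPZ hzZ
      omega
    have hne0 : (σ z : ℕ) ≠ σ 0 := fun h => by
      have := eq_of_val_apply_eq h
      rw [Fin.val_zero] at this
      rw [Fin.lt_def] at hzZ
      omega
    rcases lt_or_gt_of_ne hne0 with h0 | h0
    · refine hno 0 P Z z ⟨hP0, hPZ, hzZ, Or.inr (Or.inr (Or.inl ⟨?_, ?_, ?_⟩))⟩ <;>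
        rw [Fin.lt_def] <;> omega
    · refine hno 0 P Z z ⟨hP0, hPZ, hzZ, Or.inr (Or.inr (Or.inr ⟨?_, ?_, ?_⟩))⟩ <;>
        rw [Fin.lt_def] <;> omega
  refine hE ⟨n + 1 - Z, by omega, by omega, fun i hi => ?_⟩
  have := apply_eq_sub_of_increasing hord hlt (fun x hx => by rw [Fin.ext hx]; exact hZ) i
    (by omega) (by omega)
  omega

theorem exists_evilStep_of_endsWithIdentity {n : ℕ} {σ : Perm (Fin (n + 1))} (h : IsEvil σ)
    (hE : EndsWithIdentity σ) : ∃ (x : EvilLetter) (π : Perm (Fin n)), EvilStep x π σ := by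
  obtain ⟨t, hs⟩ := endsWithIdentity_iff.1 hE
  obtain ⟨π, hπ⟩ := exists_insertion_eq σ (Fin.last n)
  have hl := hs.val_last
  cases n with
  | zero =>
    refine ⟨.s, π, ?_⟩
    have : σ = insertion 0 0 π := Subsingleton.elim (α := Perm (Fin 1)) _ _
    rw [this]
    exact .s_zero π
  | succ n =>
    by_cases h0 : σ (Fin.last (n + 1)) = 0
    · rw [h0] at hπ
      subst hπ
      exact ⟨.r, π, .r π h.of_insertion⟩
    · have ht : 1 < t := by
        rw [Fin.ext_iff, Fin.val_zero] at h0
        omega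
      obtain ⟨t, rfl⟩ : ∃ t', t = t' + 1 := ⟨t - 1, by omega⟩
      rw [← hπ] at hs
      have hs' := hs.of_insertion_last (by omega)
      have hl' := hs'.val_last
      have : σ (Fin.last (n + 1)) = (π (Fin.last n)).succ := by
        ext
        rw [Fin.val_succ]
        omega
      rw [this] at hπ
      subst hπ
      exact ⟨.s, π, .s_succ π h.of_insertion (endsWithIdentity_iff.2 ⟨t, hs'⟩)⟩

theorem exists_evilStep_of_wrapped {n a b : ℕ} {σ : Perm (Fin (n + 1))} (h : IsEvil σ)
    (hw : Wrapped a b σ) : ∃ π : Perm (Fin n), EvilStep .q π σ := by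
  obtain ⟨hb, hab, h0, -⟩ := id hw
  set i : Fin (n + 1) := ⟨n + 1 - b, by omega⟩ with hi
  set j : Fin (n + 1) := ⟨a + 1, by omega⟩ with hj
  set t : Fin n := ⟨a + b - 1, by omega⟩ with ht
  have hi' : (i : ℕ) + b = n + 1 := by rw [hi]; dsimp only; omega
  have ht' : (t : ℕ) + 1 = a + b := by rw [ht]; dsimp only; omega
  obtain ⟨π, hπ⟩ := exists_insertion_eq (σ * Fin.cycleIcc j i) 0
  have e0 : (σ * Fin.cycleIcc j i) 0 = t.succ := by
    have e : Fin.cycleIcc j i 0 = 0 := by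
      ext
      rw [val_cycleIcc, if_pos (Or.inl (by simp [hj]))]
    rw [Perm.mul_apply, e]
    ext
    rw [Fin.val_succ, h0, ht']
  rw [e0] at hπ
  have hσ : σ = shift i j (insertion t.succ 0 π) := by rw [hπ, shift, mul_inv_cancel_right]
  rw [hσ] at hw h ⊢
  have hs := (sandwiched_iff_wrapped hb hab ht' hi' rfl).2 hw
  have hle := hs.least_recoil hab ht'
  refine ⟨π, .q_sandwiched π (isEvil_of_shift hs hab ht' hi' rfl h) ?_ t hle a b hs i j hi' rfl⟩
  rintro rfl
  have := hle.1
  rw [recoils_one] at this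
  exact this

theorem exists_evilStep_of_not_wrapped {n : ℕ} {σ : Perm (Fin (n + 1))} (h : IsEvil σ)
    (hE : ¬ EndsWithIdentity σ) (h0 : σ 0 ≠ 0) (hw : ¬ ∃ a b, Wrapped a b σ) :
    ∃ π : Perm (Fin n), EvilStep .q π σ := by
  have hno := isEvil_iff.1 h
  have hord : ∀ x y, σ x < σ y → (σ y : ℕ) < σ 0 → x < y := fun x y => h.lt_of_apply_lt hE
  obtain ⟨t, ht⟩ := Fin.exists_succ_eq.2 h0
  have ht' : (σ 0 : ℕ) = t + 1 := by rw [← ht, Fin.val_succ]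
  have h1 : ∀ x : Fin (n + 1), (x : ℕ) = 1 → (∀ x : Fin (n + 1), (x : ℕ) = 1 →
      (σ x : ℕ) < σ 0) → (σ x : ℕ) = 0 := by
    intro x hx hlt
    by_contra hne
    obtain ⟨z, hz⟩ := exists_val_apply_eq σ (v := 0) (by omega)
    have := hord z x (by rw [Fin.lt_def]; omega) (hlt x hx)
    have hz0 : z = 0 := by ext; rw [Fin.lt_def] at this; rw [Fin.val_zero]; omega
    rw [hz0] at hz
    omega
  -- the first entry is not the largest value
  have htn : (t : ℕ) + 1 < n := by
    by_contra! hle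
    have htn := t.2
    refine hE ⟨n, by omega, by omega, fun i hi => ?_⟩
    have hlt : ∀ x : Fin (n + 1), 1 ≤ (x : ℕ) → (x : ℕ) ≤ n → (σ x : ℕ) < σ 0 := by
      intro x hx _
      have : (σ x : ℕ) ≠ σ 0 := fun h => by
        have := eq_of_val_apply_eq h
        rw [Fin.val_zero] at this
        omega
      omega
    have := apply_eq_sub_of_increasing hord hlt
      (fun x hx => h1 x hx fun x hx => hlt x (by omega) (by omega)) i (by omega) (by omega)
    omega
  obtain ⟨z, hz⟩ := exists_val_apply_eq σ (v := t + 2) (by omega)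
  obtain ⟨T, hT⟩ := exists_val_apply_eq σ (v := t) (by omega)
  -- otherwise `2413` is only avoided if `σ` starts with `t + 1, 0, …, t`, and then it is wrapped
  have hzT : z < T := by
    by_contra! hle
    have hne : T ≠ z := by rintro rfl; omega
    have hTz : T < z := lt_of_le_of_ne hle hne
    have hlt : ∀ x : Fin (n + 1), 1 ≤ (x : ℕ) → (x : ℕ) ≤ T → (σ x : ℕ) < σ 0 := by
      intro x hx hxT
      by_contra! hge
      have hx0 : (σ x : ℕ) ≠ σ 0 := fun h => by
        have := eq_of_val_apply_eq h
        rw [Fin.val_zero] at this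
        omega
      have hxT' : x < T := lt_of_le_of_ne hxT (by rintro rfl; omega)
      have hxz : (σ x : ℕ) ≠ σ z := fun h => by
        have := eq_of_val_apply_eq h
        rw [Fin.lt_def] at hxT' hTz
        omega
      refine hno 0 x T z ⟨Fin.pos_iff_ne_zero.2 (by rintro rfl; omega), hxT', hTz,
        Or.inl ⟨?_, ?_, ?_⟩⟩ <;> rw [Fin.lt_def] <;> omega
    have hT0 : 1 ≤ (T : ℕ) := Nat.pos_of_ne_zero fun h => by
      have : T = 0 := by ext; rw [Fin.val_zero, h]
      rw [this] at hT
      omega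
    have key := apply_eq_sub_of_increasing hord hlt
      (fun x hx => h1 x hx fun x hx => hlt x (by omega) (by omega))
    have eT := key T hT0 le_rfl
    refine hw ⟨t, 1, one_pos, htn, ht', fun x hx hxt => ?_, fun x hx => ?_⟩
    · have := key x hx (by omega)
      omega
    · omega
  obtain ⟨π, hπ⟩ := exists_insertion_eq σ 0
  rw [← ht] at hπ
  have hle : IsLeast (recoils π) t := by
    constructor
    · have hz0 : z ≠ 0 := by rintro rfl; omega
      obtain ⟨z, rfl⟩ := Fin.exists_succ_eq.2 hz0
      obtain ⟨T, rfl⟩ := Fin.exists_succ_eq.2 (Fin.ne_zero_of_lt hzT)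
      rw [← hπ, insertion_zero_succ, val_succAbove, Fin.val_succ] at hz hT
      have ez : (⟨(t : ℕ) + 1, htn⟩ : Fin n) = π z := by
        ext
        dsimp only
        split_ifs at hz <;> omega
      have eT : t = π T := by
        ext
        split_ifs at hT <;> omega
      refine ⟨htn, ?_⟩
      have e : π⁻¹ t = T := by rw [Perm.inv_def, symm_apply_eq]; exact eT
      rw [ez, e, Perm.inv_def, symm_apply_apply]
      exact Fin.succ_lt_succ_iff.1 hzT
    · intro w hw'
      by_contra! hlt
      rw [Fin.lt_def] at hlt
      have hr := (succAbove_mem_recoils_insertion t.succ 0 π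
        (by rw [Fin.val_succ]; omega : (w : ℕ) + 1 ≠ (t.succ : Fin (n + 1)))).2 hw'
      rw [hπ] at hr
      obtain ⟨hw1, hw2⟩ := hr
      have ew := val_succAbove t.succ w
      rw [Fin.val_succ, if_pos (by omega)] at ew
      have := hord (σ⁻¹ (t.succ.succAbove w)) (σ⁻¹ ⟨(t.succ.succAbove w : ℕ) + 1, hw1⟩)
        (by rw [Perm.inv_def, apply_symm_apply, apply_symm_apply, Fin.lt_def]; dsimp only; omega)
        (by rw [Perm.inv_def, apply_symm_apply]; dsimp only; omega)
      exact lt_asymm hw2 this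
  have h1 : π ≠ 1 := by
    rintro rfl
    have := hle.1
    rw [recoils_one] at this
    exact this
  have hs : ¬ ∃ a b, Sandwiched a b π := by
    rintro ⟨a, b, hs⟩
    have hab := hs.lt_of_ne_one h1
    have htab := val_add_one_eq_of_isLeast hle h1 hs
    obtain ⟨hpre, hsuf⟩ := (sandwiched_iff_insertion hs.1 hab htab).1 hs
    rw [hπ] at hpre hsuf
    have hb := hs.1
    rcases Nat.eq_zero_or_pos a with rfl | ha
    · refine hE ⟨b, hb, by omega, fun x hx => ?_⟩
      have := hsuf x hx
      omega
    · refine hw ⟨a - 1, b + 1, by omega, by omega, by omega, fun x hx hxa => ?_, fun x hx => ?_⟩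
      · exact hpre x hx (by omega)
      · have := hsuf x (by omega)
        omega
  refine ⟨π, hπ ▸ .q_plain π (IsEvil.of_insertion (hπ ▸ h)) h1 t hle hs⟩

theorem exists_evilStep {n : ℕ} {σ : Perm (Fin (n + 1))} (h : IsEvil σ) :
    ∃ (x : EvilLetter) (π : Perm (Fin n)), EvilStep x π σ := by
  by_cases hE : EndsWithIdentity σ
  · exact exists_evilStep_of_endsWithIdentity h hE
  by_cases h0 : σ 0 = 0
  · obtain ⟨π, hπ⟩ := exists_insertion_eq σ 0
    rw [h0] at hπ
    subst hπ
    refine ⟨.p, π, .p π h.of_insertion ?_⟩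
    rintro rfl
    refine hE ⟨n + 1, by omega, le_rfl, fun i _ => ?_⟩
    induction i using Fin.cases <;> simp
  by_cases hw : ∃ a b, Wrapped a b σ
  · obtain ⟨a, b, hw⟩ := hw
    obtain ⟨π, hπ⟩ := exists_evilStep_of_wrapped h hw
    exact ⟨.q, π, hπ⟩
  · obtain ⟨π, hπ⟩ := exists_evilStep_of_not_wrapped h hE h0 hw
    exact ⟨.q, π, hπ⟩

/-! ### Encodings of permutations by words -/

/-- The word `x₁ x₂ ⋯ x_m` leads from the permutation of `S_0` to `π` by steps of the relation
`Step`, the last letter of the word being the first step. -/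
inductive Encodes {α : Type*} (Step : α → ∀ {n : ℕ}, Perm (Fin n) → Perm (Fin (n + 1)) → Prop) :
    List α → ∀ {n : ℕ}, Perm (Fin n) → Prop
  | nil : Encodes Step [] (1 : Perm (Fin 0))
  | cons {w : List α} {n : ℕ} {π : Perm (Fin n)} {σ : Perm (Fin (n + 1))}
      (x : α) (hw : Encodes Step w π) (hx : Step x π σ) : Encodes Step (x :: w) σ

/-- The relation `Step` generates each member of the class `C` in exactly one way, and exactly the
steps labelled `d` create a recoil. -/
structure IsEncoding {α : Type*} [DecidableEq α]
    (Step : α → ∀ {n : ℕ}, Perm (Fin n) → Perm (Fin (n + 1)) → Prop)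
    (C : ∀ n : ℕ, Set (Perm (Fin n))) (d : α) : Prop where
  one_mem : (1 : Perm (Fin 0)) ∈ C 0
  mem {x : α} {n : ℕ} {π : Perm (Fin n)} {σ : Perm (Fin (n + 1))} : Step x π σ → σ ∈ C (n + 1)
  recoilCount_eq {x : α} {n : ℕ} {π : Perm (Fin n)} {σ : Perm (Fin (n + 1))} :
    Step x π σ → recoilCount σ = recoilCount π + if x = d then 1 else 0
  right_unique {x : α} {n : ℕ} {π : Perm (Fin n)} {σ σ' : Perm (Fin (n + 1))} :
    Step x π σ → Step x π σ' → σ = σ'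
  left_unique {x x' : α} {n : ℕ} {π π' : Perm (Fin n)} {σ : Perm (Fin (n + 1))} :
    Step x π σ → Step x' π' σ → x = x' ∧ π = π'
  exists_step {n : ℕ} {σ : Perm (Fin (n + 1))} :
    σ ∈ C (n + 1) → ∃ (x : α) (π : Perm (Fin n)), π ∈ C n ∧ Step x π σ

section Encodes

variable {α : Type*} {Step : α → ∀ {n : ℕ}, Perm (Fin n) → Perm (Fin (n + 1)) → Prop}

theorem Encodes.length_eq {w : List α} {n : ℕ} {π : Perm (Fin n)} (h : Encodes Step w π) :
    w.length = n := by
  induction h with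
  | nil => rfl
  | cons x _ _ ih => rw [List.length_cons, ih]

variable [DecidableEq α] {C : ∀ n : ℕ, Set (Perm (Fin n))} {d : α}

theorem Encodes.mem (hS : IsEncoding Step C d) {w : List α} {n : ℕ} {π : Perm (Fin n)}
    (h : Encodes Step w π) : π ∈ C n := by
  cases h with
  | nil => exact hS.one_mem
  | cons x _ hx => exact hS.mem hx

theorem Encodes.recoilCount_eq (hS : IsEncoding Step C d) {w : List α} {n : ℕ} {π : Perm (Fin n)}
    (h : Encodes Step w π) : recoilCount π = w.count d := by
  induction h with
  | nil => simp [recoilCount, recoils_one]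
  | cons x _ hx ih => rw [hS.recoilCount_eq hx, ih, List.count_cons]; simp

theorem Encodes.right_unique (hS : IsEncoding Step C d) {w : List α} {n : ℕ}
    {π π' : Perm (Fin n)} (h : Encodes Step w π) (h' : Encodes Step w π') : π = π' := by
  induction h with
  | nil => exact Subsingleton.elim _ _
  | cons x _ hx ih =>
    cases h' with
    | cons _ hw' hx' =>
      rw [← ih hw'] at hx'
      exact hS.right_unique hx hx'

theorem Encodes.left_unique (hS : IsEncoding Step C d) {w w' : List α} {n : ℕ}
    {π : Perm (Fin n)} (h : Encodes Step w π) (h' : Encodes Step w' π) : w = w' := by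
  induction h generalizing w' with
  | nil => exact (List.length_eq_zero_iff.1 h'.length_eq).symm
  | cons x _ hx ih =>
    cases h' with
    | cons x' hw' hx' =>
      obtain ⟨rfl, rfl⟩ := hS.left_unique hx hx'
      rw [ih hw']

theorem IsEncoding.exists_encodes (hS : IsEncoding Step C d) {n : ℕ} {π : Perm (Fin n)}
    (h : π ∈ C n) : ∃ w, Encodes Step w π := by
  induction n with
  | zero =>
    rw [Subsingleton.elim π 1]
    exact ⟨[], .nil⟩
  | succ n ih =>
    obtain ⟨x, π', hπ', hx⟩ := hS.exists_step h
    obtain ⟨w, hw⟩ := ih hπ'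
    exact ⟨x :: w, .cons x hw hx⟩

theorem IsEncoding.existsUnique_perm (hS : IsEncoding Step C d) {w : List α} {m : ℕ}
    {π : Perm (Fin m)} (h : Encodes Step w π) :
    ∃ π ∈ {π : Perm (Fin w.length) | π ∈ C w.length ∧ recoilCount π = w.count d},
      ∀ (n : ℕ) (σ : Perm (Fin n)), Encodes Step w σ ↔
        (⟨n, σ⟩ : Σ m : ℕ, Perm (Fin m)) = ⟨w.length, π⟩ := by
  obtain rfl := h.length_eq
  refine ⟨π, ⟨h.mem hS, h.recoilCount_eq hS⟩, fun n σ => ⟨fun hσ => ?_, fun he => ?_⟩⟩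
  · obtain rfl := hσ.length_eq
    rw [h.right_unique hS hσ]
  · obtain ⟨rfl, he⟩ := Sigma.mk.inj_iff.1 he
    rwa [eq_of_heq he]

theorem IsEncoding.existsUnique_word (hS : IsEncoding Step C d) {n k : ℕ} (hn : 1 ≤ n)
    {π : Perm (Fin n)} (hπ : π ∈ C n) (hk : recoilCount π = k) :
    ∃ w ∈ {w : List α | w ≠ [] ∧ ∃ (n : ℕ) (π : Perm (Fin n)), Encodes Step w π},
      w.length = n ∧ w.count d = k ∧ ∀ w', Encodes Step w' π ↔ w' = w := by
  obtain ⟨w, hw⟩ := hS.exists_encodes hπ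
  refine ⟨w, ⟨?_, n, π, hw⟩, hw.length_eq, ?_, fun w' => ⟨fun h => h.left_unique hS hw, ?_⟩⟩
  · rintro rfl
    have := hw.length_eq
    simp at this
    omega
  · rw [← hw.recoilCount_eq hS, hk]
  · rintro rfl
    exact hw

/-- An injective map from the words of one encoding onto those of another that preserves length and
the number of recoil letters induces a bijection between the encoded permutations. -/
theorem IsEncoding.exists_equiv {β : Type*} [DecidableEq β]
    {Step' : β → ∀ {n : ℕ}, Perm (Fin n) → Perm (Fin (n + 1)) → Prop}
    {D : ∀ n : ℕ, Set (Perm (Fin n))} {r : β}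
    (hS : IsEncoding Step C d) (hS' : IsEncoding Step' D r) (f : List α → List β)
    (hcount : ∀ w, (f w).count r = w.count d)
    (hinj : Function.Injective f)
    (hmap : ∀ w n, (∃ π : Perm (Fin n), Encodes Step w π) →
      ∃ τ : Perm (Fin n), Encodes Step' (f w) τ)
    (hsurj : ∀ v n, (∃ τ : Perm (Fin n), Encodes Step' v τ) →
      ∃ w, f w = v ∧ ∃ π : Perm (Fin n), Encodes Step w π) (n k : ℕ) :
    ∃ Φ : {π : Perm (Fin n) | π ∈ C n ∧ recoilCount π = k} ≃
        {τ : Perm (Fin n) | τ ∈ D n ∧ recoilCount τ = k},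
      ∀ π τ, Φ π = τ ↔ ∃ w, Encodes Step w (π : Perm (Fin n)) ∧
        Encodes Step' (f w) (τ : Perm (Fin n)) := by
  have hex : ∀ π : {π : Perm (Fin n) | π ∈ C n ∧ recoilCount π = k},
      ∃ τ : {τ : Perm (Fin n) | τ ∈ D n ∧ recoilCount τ = k}, ∃ w,
        Encodes Step w (π : Perm (Fin n)) ∧ Encodes Step' (f w) (τ : Perm (Fin n)) := by
    rintro ⟨π, hπ, hk⟩
    obtain ⟨w, hw⟩ := hS.exists_encodes hπ
    obtain ⟨τ, hτ⟩ := hmap w n ⟨π, hw⟩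
    refine ⟨⟨τ, hτ.mem hS', ?_⟩, w, hw, hτ⟩
    rw [hτ.recoilCount_eq hS', hcount, ← hw.recoilCount_eq hS, hk]
  choose φ hφ using hex
  have hφ' : ∀ π τ, φ π = τ ↔ ∃ w, Encodes Step w (π : Perm (Fin n)) ∧
      Encodes Step' (f w) (τ : Perm (Fin n)) := by
    intro π τ
    constructor
    · rintro rfl
      exact hφ π
    · rintro ⟨w, hw, hτ⟩
      obtain ⟨w', hw', hτ'⟩ := hφ π
      obtain rfl := hw.left_unique hS hw'
      exact Subtype.ext (hτ'.right_unique hS' hτ)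
  have hbij : Function.Bijective φ := by
    constructor
    · intro π π' h
      obtain ⟨w, hw, hτ⟩ := hφ π
      obtain ⟨w', hw', hτ'⟩ := hφ π'
      rw [h] at hτ
      obtain rfl := hinj (hτ.left_unique hS' hτ')
      exact Subtype.ext (hw.right_unique hS hw')
    · rintro ⟨τ, hτ, hk⟩
      obtain ⟨v, hv⟩ := hS'.exists_encodes hτ
      obtain ⟨w, rfl, π, hw⟩ := hsurj v n ⟨τ, hv⟩
      refine ⟨⟨π, hw.mem hS, ?_⟩, (hφ' _ _).2 ⟨w, hw, hv⟩⟩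
      rw [hw.recoilCount_eq hS, ← hcount, ← hv.recoilCount_eq hS', hk]
  exact ⟨Equiv.ofBijective φ hbij, hφ'⟩

end Encodes

theorem rectEncodes_iff {w : List RectLetter} {n : ℕ} {π : Perm (Fin n)} :
    RectEncodes w π ↔ Encodes RectStep w π := by
  constructor <;> intro h
  · induction h with
    | nil => exact .nil
    | cons x _ hx ih => exact .cons x ih hx
  · induction h with
    | nil => exact .nil
    | cons x _ hx ih => exact .cons x ih hx

theorem evilEncodes_iff {w : List EvilLetter} {n : ℕ} {π : Perm (Fin n)} :
    EvilEncodes w π ↔ Encodes EvilStep w π := by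
  constructor <;> intro h
  · induction h with
    | nil => exact .nil
    | cons x _ hx ih => exact .cons x ih hx
  · induction h with
    | nil => exact .nil
    | cons x _ hx ih => exact .cons x ih hx

theorem isEncoding_rectStep :
    IsEncoding RectStep (fun n => {π : Perm (Fin n) | IsRect π}) .d where
  one_mem := isRect_iff.2 fun i => i.elim0
  mem h := h.isRect
  recoilCount_eq h := h.recoilCount_eq
  right_unique h h' := h.right_unique h'
  left_unique h h' := h.left_unique h'
  exists_step h := by
    obtain ⟨x, π, hx⟩ := exists_rectStep h
    refine ⟨x, π, ?_, hx⟩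
    cases hx <;> assumption

theorem isEncoding_evilStep :
    IsEncoding EvilStep (fun n => {π : Perm (Fin n) | IsEvil π}) .r where
  one_mem := isEvil_iff.2 fun i => i.elim0
  mem h := h.isEvil
  recoilCount_eq h := h.recoilCount_eq
  right_unique h h' := h.right_unique h'
  left_unique h h' := h.left_unique h'
  exists_step h := by
    obtain ⟨x, π, hx⟩ := exists_evilStep h
    refine ⟨x, π, ?_, hx⟩
    cases hx <;> first | assumption | exact isEvil_iff.2 fun i => i.elim0

/-! ### The words that encode permutations -/

/-- The step `x` is possible after the steps recorded in a word `w` that encodes a rectangular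
permutation: the steps `2`, `u`, `d` need a nonempty permutation, and `2`, `u` may not directly
follow the step `1`. -/
def RectAllowed (x : RectLetter) (w : List RectLetter) : Prop :=
  x = .one ∨ (w ≠ [] ∧ (x = .d ∨ w.head? ≠ some .one))

/-- The step `x` is possible after the steps recorded in a word `w` that encodes an evil-avoiding
permutation: that permutation is not the identity if and only if `r` occurs in `w`, and it ends with
its smallest values in increasing order if and only if the last step was `r` or `s`. -/
def EvilAllowed (x : EvilLetter) (w : List EvilLetter) : Prop :=
  match x with
  | .p => .r ∈ w
  | .q => .r ∈ w
  | .r => w ≠ []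
  | .s => w = [] ∨ w.head? = some .r ∨ w.head? = some .s

theorem RectEncodes.head?_eq_one_iff {w : List RectLetter} {n : ℕ} {π : Perm (Fin (n + 1))}
    (h : RectEncodes w π) : w.head? = some .one ↔ π 0 = 0 := by
  cases h with
  | cons x _ hx => simpa using hx.eq_one_iff

theorem RectEncodes.length_eq {w : List RectLetter} {n : ℕ} {π : Perm (Fin n)}
    (h : RectEncodes w π) : w.length = n :=
  (rectEncodes_iff.1 h).length_eq

theorem EvilEncodes.length_eq {w : List EvilLetter} {n : ℕ} {π : Perm (Fin n)}
    (h : EvilEncodes w π) : w.length = n :=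
  (evilEncodes_iff.1 h).length_eq

theorem RectEncodes.exists_step_iff {w : List RectLetter} {n : ℕ} {π : Perm (Fin n)}
    (h : RectEncodes w π) (x : RectLetter) : (∃ σ, RectStep x π σ) ↔ RectAllowed x w := by
  have hr : IsRect π := (rectEncodes_iff.1 h).mem isEncoding_rectStep
  have hlen := h.length_eq
  cases n with
  | zero =>
    obtain rfl := List.length_eq_zero_iff.1 hlen
    simp only [RectAllowed, ne_eq, not_true_eq_false, false_and, or_false]
    constructor
    · rintro ⟨σ, hσ⟩
      exact hσ.eq_one_iff.2 (Fin.eq_zero _)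
    · rintro rfl
      exact ⟨_, .one π hr⟩
  | succ n =>
    have hne : w ≠ [] := by
      rintro rfl
      simp at hlen
    simp only [RectAllowed, ne_eq, hne, not_false_eq_true, true_and, h.head?_eq_one_iff]
    constructor
    · rintro ⟨σ, hσ⟩
      cases hσ with
      | one _ _ => simp
      | two _ _ h0 => simp [h0]
      | u _ _ h0 => simp [h0]
      | d _ _ => simp
    · intro hx
      cases x with
      | one => exact ⟨_, .one π hr⟩
      | two => exact ⟨_, .two π hr (by simpa using hx)⟩
      | u => exact ⟨_, .u π hr (by simpa using hx)⟩
      | d => exact ⟨_, .d π hr⟩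

/-- The identity is the only permutation without recoils. -/
theorem eq_one_iff_recoils {n : ℕ} {π : Perm (Fin n)} : π = 1 ↔ recoils π = ∅ := by
  refine ⟨fun h => h ▸ recoils_one n, fun h => eq_one_of_val_apply_eq fun x => ?_⟩
  have hord : ∀ x y, π x < π y → (π y : ℕ) < n → x < y := fun x y hxy hy =>
    lt_of_apply_lt_of_recoils (t := n) (by simp [h]) hxy hy.le
  refine apply_eq_sub_of_increasing (p := 0) (q := n) hord (fun x _ _ => (π x).2) (fun x hx => ?_) x
    (by omega) x.2.le
  obtain ⟨z, hz⟩ := exists_val_apply_eq π (v := 0) (by omega)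
  by_contra hne
  have := hord z x (by rw [Fin.lt_def]; omega) (π x).2
  rw [Fin.lt_def] at this
  omega

theorem EvilEncodes.ne_one_iff {w : List EvilLetter} {n : ℕ} {π : Perm (Fin n)}
    (h : EvilEncodes w π) : π ≠ 1 ↔ .r ∈ w := by
  rw [← List.count_pos_iff, ← (evilEncodes_iff.1 h).recoilCount_eq isEncoding_evilStep, recoilCount,
    Set.ncard_pos, ne_eq, eq_one_iff_recoils, Set.nonempty_iff_ne_empty]

theorem EvilEncodes.head?_iff {w : List EvilLetter} {n : ℕ} {π : Perm (Fin (n + 1))}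
    (h : EvilEncodes w π) : w.head? = some .r ∨ w.head? = some .s ↔ EndsWithIdentity π := by
  cases h with
  | cons x _ hx => simpa using hx.eq_r_or_eq_s_iff

theorem exists_evilStep_q {n : ℕ} {π : Perm (Fin n)} (h : IsEvil π) (h1 : π ≠ 1) :
    ∃ σ, EvilStep .q π σ := by
  obtain ⟨t, ht⟩ : ∃ t, IsLeast (recoils π) t := by
    have hne : (recoils π).Nonempty := by
      rwa [Set.nonempty_iff_ne_empty, ne_eq, ← eq_one_iff_recoils]
    obtain ⟨t, ht, hmin⟩ := wellFounded_lt.has_min (recoils π) hne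
    exact ⟨t, ht, fun v hv => not_lt.1 (hmin v hv)⟩
  by_cases hs : ∃ a b, Sandwiched a b π
  · obtain ⟨a, b, hs⟩ := hs
    have hb := hs.1
    have hab := hs.2.1
    exact ⟨_, .q_sandwiched π h h1 t ht a b hs ⟨n + 1 - b, by omega⟩ ⟨a + 1, by omega⟩
      (by dsimp only; omega) rfl⟩
  · exact ⟨_, .q_plain π h h1 t ht hs⟩

theorem EvilEncodes.exists_step_iff {w : List EvilLetter} {n : ℕ} {π : Perm (Fin n)}
    (h : EvilEncodes w π) (x : EvilLetter) : (∃ σ, EvilStep x π σ) ↔ EvilAllowed x w := by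
  have hr : IsEvil π := (evilEncodes_iff.1 h).mem isEncoding_evilStep
  have hlen := h.length_eq
  cases x with
  | p =>
    rw [EvilAllowed, ← h.ne_one_iff]
    constructor
    · rintro ⟨σ, hσ⟩
      cases hσ; assumption
    · exact fun h1 => ⟨_, .p π hr h1⟩
  | q =>
    rw [EvilAllowed, ← h.ne_one_iff]
    constructor
    · rintro ⟨σ, hσ⟩
      cases hσ <;> assumption
    · exact exists_evilStep_q hr
  | r =>
    rw [EvilAllowed]
    constructor
    · rintro ⟨σ, hσ⟩
      cases hσ
      rintro rfl
      simp at hlen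
    · intro hne
      cases n with
      | zero => exact absurd (List.length_eq_zero_iff.1 hlen) hne
      | succ n => exact ⟨_, .r π hr⟩
  | s =>
    rw [EvilAllowed]
    constructor
    · rintro ⟨σ, hσ⟩
      cases hσ with
      | s_zero => exact Or.inl (List.length_eq_zero_iff.1 hlen)
      | s_succ _ _ hs => exact Or.inr (h.head?_iff.2 hs)
    · intro hw
      cases n with
      | zero => exact ⟨_, .s_zero π⟩
      | succ n =>
        refine ⟨_, .s_succ π hr (h.head?_iff.1 (hw.resolve_left ?_))⟩
        rintro rfl
        simp at hlen

/-- The letter `x` may be directly followed by `y` in the image of a word of `LRect` under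
`letterMap`. -/
def Precedes (x y : EvilLetter) : Prop := x = .p ∨ x = .q → y ≠ .s

theorem precedes_r (x : EvilLetter) : Precedes x .r := by simp [Precedes]

theorem r_precedes (y : EvilLetter) : Precedes .r y := by simp [Precedes]

theorem exists_rectEncodes_cons_iff {x : RectLetter} {w : List RectLetter} :
    (∃ (n : ℕ) (π : Perm (Fin n)), RectEncodes (x :: w) π) ↔
      (∃ (n : ℕ) (π : Perm (Fin n)), RectEncodes w π) ∧ RectAllowed x w := by
  constructor
  · rintro ⟨n, σ, h⟩
    cases h with
    | cons _ hw hx => exact ⟨⟨_, _, hw⟩, (hw.exists_step_iff x).1 ⟨_, hx⟩⟩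
  · rintro ⟨⟨n, π, hw⟩, hx⟩
    obtain ⟨σ, hσ⟩ := (hw.exists_step_iff x).2 hx
    exact ⟨_, _, .cons x hw hσ⟩

theorem exists_evilEncodes_cons_iff {x : EvilLetter} {w : List EvilLetter} :
    (∃ (n : ℕ) (π : Perm (Fin n)), EvilEncodes (x :: w) π) ↔
      (∃ (n : ℕ) (π : Perm (Fin n)), EvilEncodes w π) ∧ EvilAllowed x w := by
  constructor
  · rintro ⟨n, σ, h⟩
    cases h with
    | cons _ hw hx => exact ⟨⟨_, _, hw⟩, (hw.exists_step_iff x).1 ⟨_, hx⟩⟩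
  · rintro ⟨⟨n, π, hw⟩, hx⟩
    obtain ⟨σ, hσ⟩ := (hw.exists_step_iff x).2 hx
    exact ⟨_, _, .cons x hw hσ⟩

theorem exists_rectEncodes_iff {w : List RectLetter} :
    (∃ (n : ℕ) (π : Perm (Fin n)), RectEncodes w π) ↔
      (w.map letterMap).IsChain Precedes ∧ ∀ c ∈ (w.map letterMap).getLast?, c = .s := by
  induction w with
  | nil => simpa using ⟨0, 1, RectEncodes.nil⟩
  | cons x w ih =>
    rw [exists_rectEncodes_cons_iff, ih]
    cases w with
    | nil => cases x <;> simp [RectAllowed, letterMap]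
    | cons y w =>
      simp only [List.map_cons, List.isChain_cons_cons, List.getLast?_cons_cons]
      have : RectAllowed x (y :: w) ↔ Precedes (letterMap x) (letterMap y) := by
        cases x <;> cases y <;> simp [RectAllowed, Precedes, letterMap]
      rw [this]
      tauto

/-- The words in `p, q, s` that encode permutations are those in `s` alone. -/
theorem exists_evilEncodes_iff_of_r_notMem {v : List EvilLetter} (hv : .r ∉ v) :
    (∃ (n : ℕ) (π : Perm (Fin n)), EvilEncodes v π) ↔ ∀ c ∈ v, c = .s := by
  induction v with
  | nil => simpa using ⟨0, 1, EvilEncodes.nil⟩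
  | cons x v ih =>
    have hv' : .r ∉ v := fun h => hv (List.mem_cons_of_mem _ h)
    rw [exists_evilEncodes_cons_iff, ih hv', List.forall_mem_cons, and_comm]
    refine and_congr_left fun h => ?_
    cases x with
    | p => simpa [EvilAllowed] using hv'
    | q => simpa [EvilAllowed] using hv'
    | r => simp at hv
    | s =>
      cases v with
      | nil => simp [EvilAllowed]
      | cons y v =>
        have := h y (by simp)
        simp [EvilAllowed, this]

theorem exists_evilEncodes_append_iff {x y : List EvilLetter} (hy : .r ∉ y) :
    (∃ (n : ℕ) (π : Perm (Fin n)), EvilEncodes (x ++ .r :: y) π) ↔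
      x.IsChain (fun a b => Precedes b a) ∧ y ≠ [] ∧ ∀ c ∈ y, c = .s := by
  induction x with
  | nil =>
    rw [List.nil_append, exists_evilEncodes_cons_iff, exists_evilEncodes_iff_of_r_notMem hy]
    simp [EvilAllowed, and_comm]
  | cons a x ih =>
    rw [List.cons_append, exists_evilEncodes_cons_iff, ih]
    cases x with
    | nil => cases a <;> simp [EvilAllowed]
    | cons b x =>
      rw [List.isChain_cons_cons]
      have : EvilAllowed a (b :: x ++ .r :: y) ↔ Precedes b a := by
        cases a <;> cases b <;> simp [EvilAllowed, Precedes]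
      rw [this]
      tauto

theorem isChain_precedes_iff_of_r_notMem {v : List EvilLetter} (hv : .r ∉ v) :
    (v.IsChain Precedes ∧ ∀ c ∈ v.getLast?, c = .s) ↔ ∀ c ∈ v, c = .s := by
  induction v with
  | nil => simp
  | cons x v ih =>
    have hv' : .r ∉ v := fun h => hv (List.mem_cons_of_mem _ h)
    cases v with
    | nil => simp
    | cons y v =>
      rw [List.isChain_cons_cons, List.getLast?_cons_cons, and_assoc, ih hv',
        List.forall_mem_cons (a := x)]
      refine and_congr_left fun h => ?_
      rw [h y (by simp)]
      cases x <;> simp [Precedes] at hv ⊢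

theorem isChain_precedes_append_iff {x y : List EvilLetter} (hy : .r ∉ y) :
    ((x ++ .r :: y).IsChain Precedes ∧ ∀ c ∈ (x ++ .r :: y).getLast?, c = .s) ↔
      x.IsChain Precedes ∧ y ≠ [] ∧ ∀ c ∈ y, c = .s := by
  rw [List.isChain_append, ← isChain_precedes_iff_of_r_notMem hy, List.isChain_cons,
    List.getLast?_append]
  cases y with
  | nil => simp
  | cons b y => simp [precedes_r, r_precedes, List.getLast?_cons_cons]; tauto

/-! ### The map between words -/

theorem exists_append_r_of_mem {v : List EvilLetter} (h : .r ∈ v) :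
    ∃ x y, v = x ++ .r :: y ∧ .r ∉ y := by
  obtain ⟨y, x, hv, hy⟩ := List.eq_append_cons_of_mem (List.mem_reverse.2 h)
  refine ⟨x.reverse, y.reverse, ?_, by simpa using hy⟩
  rw [← List.reverse_reverse v, hv]
  simp

theorem reversePrefix_append {x y : List EvilLetter} (hy : .r ∉ y) :
    reversePrefix (x ++ .r :: y) = x.reverse ++ .r :: y := by
  have hall : ∀ c ∈ y, c ≠ .r := fun c hc h => hy (h ▸ hc)
  have h1 : (x ++ .r :: y).rdropWhile (· ≠ .r) = x ++ [.r] := by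
    induction y using List.reverseRecOn with
    | nil => simp
    | append_singleton y c ih =>
      rw [← List.cons_append, ← List.append_assoc, List.rdropWhile_concat_pos]
      · exact ih (fun h => hy (by simp [h])) fun c hc => hall c (by simp [hc])
      · simpa using hall c (by simp)
  have h2 := List.rdropWhile_append_rtakeWhile (p := (· ≠ .r)) (l := x ++ .r :: y)
  rw [h1, List.append_assoc] at h2
  have h3 := List.append_cancel_left h2
  rw [reversePrefix, if_pos (by simp), h1]
  simp at h3 ⊢
  exact h3

theorem reversePrefix_of_notMem {v : List EvilLetter} (h : .r ∉ v) : reversePrefix v = v :=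
  if_neg h

theorem reversePrefix_involutive : Function.Involutive reversePrefix := by
  intro v
  by_cases h : .r ∈ v
  · obtain ⟨x, y, rfl, hy⟩ := exists_append_r_of_mem h
    rw [reversePrefix_append hy, reversePrefix_append hy, List.reverse_reverse]
  · rw [reversePrefix_of_notMem h, reversePrefix_of_notMem h]

theorem reversePrefix_perm (v : List EvilLetter) : (reversePrefix v).Perm v := by
  by_cases h : .r ∈ v
  · obtain ⟨x, y, rfl, hy⟩ := exists_append_r_of_mem h
    rw [reversePrefix_append hy]
    exact (List.reverse_perm x).append_right _
  · rw [reversePrefix_of_notMem h]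

theorem letterMap_injective : Function.Injective letterMap := by
  intro x y
  cases x <;> cases y <;> simp [letterMap]

theorem letterMap_surjective : Function.Surjective letterMap
  | .p => ⟨.two, rfl⟩
  | .q => ⟨.u, rfl⟩
  | .r => ⟨.d, rfl⟩
  | .s => ⟨.one, rfl⟩

theorem wordMap_injective : Function.Injective wordMap :=
  reversePrefix_involutive.injective.comp (List.map_injective_iff.2 letterMap_injective)

theorem wordMap_surjective : Function.Surjective wordMap :=
  reversePrefix_involutive.surjective.comp (List.map_surjective_iff.2 letterMap_surjective)

theorem length_wordMap (w : List RectLetter) : (wordMap w).length = w.length := by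
  rw [wordMap, (reversePrefix_perm _).length_eq, List.length_map]

theorem count_wordMap (w : List RectLetter) : (wordMap w).count .r = w.count .d := by
  rw [wordMap, (reversePrefix_perm _).count_eq]
  exact List.count_map_of_injective w letterMap letterMap_injective .d

/-- Reversing the prefix before the last `r` turns the condition on neighbouring letters in the
words of one language into that of the other. -/
theorem exists_evilEncodes_wordMap_iff {w : List RectLetter} :
    (∃ (n : ℕ) (τ : Perm (Fin n)), EvilEncodes (wordMap w) τ) ↔
      ∃ (n : ℕ) (π : Perm (Fin n)), RectEncodes w π := by
  rw [exists_rectEncodes_iff, wordMap]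
  generalize w.map letterMap = v
  by_cases h : .r ∈ v
  · obtain ⟨x, y, rfl, hy⟩ := exists_append_r_of_mem h
    rw [reversePrefix_append hy, exists_evilEncodes_append_iff hy, isChain_precedes_append_iff hy,
      List.isChain_reverse]
  · rw [reversePrefix_of_notMem h, exists_evilEncodes_iff_of_r_notMem h,
      isChain_precedes_iff_of_r_notMem h]

theorem wordMap_mem_LEvil_iff {w : List RectLetter} : wordMap w ∈ LEvil ↔ w ∈ LRect := by
  refine and_congr ?_ exists_evilEncodes_wordMap_iff
  rw [ne_eq, ne_eq, ← List.length_eq_zero_iff, length_wordMap, List.length_eq_zero_iff]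

theorem exists_evilEncodes_wordMap_iff_of_length {w : List RectLetter} {n : ℕ} :
    (∃ τ : Perm (Fin n), EvilEncodes (wordMap w) τ) ↔ ∃ π : Perm (Fin n), RectEncodes w π := by
  constructor
  · rintro ⟨τ, hτ⟩
    obtain ⟨m, π, hπ⟩ := exists_evilEncodes_wordMap_iff.1 ⟨n, τ, hτ⟩
    obtain rfl : m = n := by rw [← hπ.length_eq, ← hτ.length_eq, length_wordMap]
    exact ⟨π, hπ⟩
  · rintro ⟨π, hπ⟩
    obtain ⟨m, τ, hτ⟩ := exists_evilEncodes_wordMap_iff.2 ⟨n, π, hπ⟩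
    obtain rfl : m = n := by rw [← hπ.length_eq, ← hτ.length_eq, length_wordMap]
    exact ⟨τ, hτ⟩

theorem exists_rect_equiv_evil (n k : ℕ) : ∃ Φ : Rect n k ≃ Evil n k,
    ∀ (π : Rect n k) (τ : Evil n k), Φ π = τ ↔
      ∃ w : List RectLetter, RectEncodes w (π : Perm (Fin n)) ∧
        EvilEncodes (wordMap w) (τ : Perm (Fin n)) := by
  simp only [rectEncodes_iff, evilEncodes_iff]
  refine isEncoding_rectStep.exists_equiv isEncoding_evilStep wordMap count_wordMap
    wordMap_injective (fun w n hw => ?_) (fun v n hv => ?_) n k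
  · simp only [← rectEncodes_iff, ← evilEncodes_iff] at hw ⊢
    exact exists_evilEncodes_wordMap_iff_of_length.2 hw
  · obtain ⟨w, rfl⟩ := wordMap_surjective v
    simp only [← rectEncodes_iff, ← evilEncodes_iff] at hv ⊢
    exact ⟨w, rfl, exists_evilEncodes_wordMap_iff_of_length.1 hv⟩

end RectEvil

theorem mainTheorem1 :
    -- words of `LRect` of length `n` with `k` letters `d` encode `Rect n k`, for `n ≥ 1`
    ((∀ w ∈ RectEvil.LRect, ∃ π ∈ RectEvil.Rect w.length (w.count .d),
        ∀ (n : ℕ) (σ : Equiv.Perm (Fin n)), RectEvil.RectEncodes w σ ↔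
          (⟨n, σ⟩ : Σ m : ℕ, Equiv.Perm (Fin m)) = ⟨w.length, π⟩) ∧
      (∀ n : ℕ, 1 ≤ n → ∀ k : ℕ, ∀ π ∈ RectEvil.Rect n k, ∃ w ∈ RectEvil.LRect,
        w.length = n ∧ w.count .d = k ∧ ∀ w', RectEvil.RectEncodes w' π ↔ w' = w)) ∧
    -- words of `LEvil` of length `n` with `k` letters `r` encode `Evil n k`, for `n ≥ 1`
    ((∀ w ∈ RectEvil.LEvil, ∃ π ∈ RectEvil.Evil w.length (w.count .r),
        ∀ (n : ℕ) (σ : Equiv.Perm (Fin n)), RectEvil.EvilEncodes w σ ↔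
          (⟨n, σ⟩ : Σ m : ℕ, Equiv.Perm (Fin m)) = ⟨w.length, π⟩) ∧
      (∀ n : ℕ, 1 ≤ n → ∀ k : ℕ, ∀ π ∈ RectEvil.Evil n k, ∃ w ∈ RectEvil.LEvil,
        w.length = n ∧ w.count .r = k ∧ ∀ w', RectEvil.EvilEncodes w' π ↔ w' = w)) ∧
    -- the explicit map of words is a length-preserving bijection turning `d`s into `r`s
    (Set.BijOn RectEvil.wordMap RectEvil.LRect RectEvil.LEvil ∧
      ∀ w ∈ RectEvil.LRect, (RectEvil.wordMap w).length = w.length ∧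
        (RectEvil.wordMap w).count .r = w.count .d) ∧
    -- the induced map of permutations is a bijection, for all `n` and `k`
    (∀ n k : ℕ, ∃ Φ : RectEvil.Rect n k ≃ RectEvil.Evil n k,
      ∀ (π : RectEvil.Rect n k) (τ : RectEvil.Evil n k), Φ π = τ ↔
        ∃ w : List RectEvil.RectLetter, RectEvil.RectEncodes w (π : Equiv.Perm (Fin n)) ∧
          RectEvil.EvilEncodes (RectEvil.wordMap w) (τ : Equiv.Perm (Fin n))) ∧
    RectEvil.StronglyWilfEquivalent
      (fun n => {π : Equiv.Perm (Fin n) | RectEvil.IsRect π})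
      (fun n => {π : Equiv.Perm (Fin n) | RectEvil.IsEvil π}) := by
  refine ⟨⟨?_, ?_⟩, ⟨?_, ?_⟩, ⟨⟨?_, ?_, ?_⟩, ?_⟩, RectEvil.exists_rect_equiv_evil, ?_⟩
  · rintro w ⟨-, n, π, h⟩
    simp only [RectEvil.rectEncodes_iff] at h ⊢
    exact RectEvil.isEncoding_rectStep.existsUnique_perm h
  · rintro n hn k π ⟨hπ, hk⟩
    simp only [RectEvil.LRect, RectEvil.rectEncodes_iff]
    exact RectEvil.isEncoding_rectStep.existsUnique_word hn hπ hk
  · rintro w ⟨-, n, π, h⟩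
    simp only [RectEvil.evilEncodes_iff] at h ⊢
    exact RectEvil.isEncoding_evilStep.existsUnique_perm h
  · rintro n hn k π ⟨hπ, hk⟩
    simp only [RectEvil.LEvil, RectEvil.evilEncodes_iff]
    exact RectEvil.isEncoding_evilStep.existsUnique_word hn hπ hk
  · exact fun w hw => RectEvil.wordMap_mem_LEvil_iff.2 hw
  · exact RectEvil.wordMap_injective.injOn
  · intro v hv
    obtain ⟨w, rfl⟩ := RectEvil.wordMap_surjective v
    exact ⟨w, RectEvil.wordMap_mem_LEvil_iff.1 hv, rfl⟩
  · exact fun w _ => ⟨RectEvil.length_wordMap w, RectEvil.count_wordMap w⟩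
  · intro n k
    obtain ⟨Φ, -⟩ := RectEvil.exists_rect_equiv_evil n k
    exact Nat.card_congr Φ
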